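/- Let $\mathcal C=(\mathcal C,\otimes,e,T)$ be a triangulated tensor category: a triangulated category with suspension $T$ and an additive monoidal structure with unit $e$, together with natural isomorphisms $\lambda\colon x\otimes Ty\cong T(x\otimes y)$ and $\rho\colon Tx\otimes y\cong T(x\otimes y)$ that are compatible with the unit isomorphisms $e\otimes x\cong x$ and $x\otimes e\cong x$ and satisfy $T(\lambda_{x,y})\circ\rho_{x,Ty}=-T(\rho_{x,y})\circ\lambda_{Tx,y}$. Let $\mathcal C$ act on a triangulated category $\mathcal A=(\mathcal A,\Sigma)$: there is an action $*\colon\mathcal C\times\mathcal A\to\mathcal A$ of the monoidal category $\mathcal C$, with unit isomorphism $\mathfrak l'_a\colon e*a\cong a$, additive in each variable, together with natural isomorphisms $\lambda'\colon x*\Sigma a\cong\Sigma(x*a)$ and $\rho'\colon Tx*a\cong\Sigma(x*a)$ such that $\Sigma(\mathfrak l'_a)\circ\lambda'_{e,a}=\mathfrak l'_{\Sigma a}$ and $\Sigma(\lambda'_{x,a})\circ\rho'_{x,\Sigma a}=-\Sigma(\rho'_{x,a})\circ\lambda'_{Tx,a}$. No exactness of $\otimes$ or $*$ is assumed. Put $\operatorname{Hom}^*_{\mathcal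 A}(a,b)=\bigoplus_{p\in\mathbb Z}\operatorname{Hom}_{\mathcal A}(a,\Sigma^p b)$ and $\operatorname{End}^*_{\mathcal C}(e)=\bigoplus_{p\in\mathbb Z}\operatorname{Hom}_{\mathcal C}(e,T^pe)$. Let $H=\bigoplus_{i\ge 0}H^i$ be a graded-commutative Noetherian ring (that is, $xy=(-1)^{|x||y|}yx$ for homogeneous $x,y$) with a homomorphism of graded rings $H\to\operatorname{End}^*_{\mathcal C}(e)$. An element $h\colon e\to T^pe$ of $\operatorname{End}^*_{\mathcal C}(e)$ acts on $\operatorname{Hom}^*_{\mathcal A}(a,b)$ from the left through the endomorphism $b\cong e*b\xrightarrow{h*1}T^pe*b\cong\Sigma^p(e*b)\cong\Sigma^p b$, where the middle isomorphism is the iterate of $\rho'$. In this way $\operatorname{Hom}^*_{\mathcal A}(a,b)$ is a left $H$-module. Assume that it is finitely generated for all objects $a,b$ of $\mathcal A$. Let $\operatorname{Spec}H$ be the set of homogeneous prime ideals of $H$. For an object $a$ of $\mathcal A$ let $V(a)=\{\mathfrak p\in\operatorname{Spec}H\mid \operatorname{Hom}^*_{\mathcal A}(a,a)_{\mathfrak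 p}\ne 0\}$. Let $H^+$ be the ideal of $H$ generated by the nilradical of $H^0$ and by all $H^i$ with $i\ge1$, and let $V(H^+)=\{\mathfrak p\in\operatorname{Spec}H\mid (H/H^+)_{\mathfrak p}\neq 0\}$. The object $a$ is called *perfect* if $V(a)\subseteq V(H^+)$, and $\mathcal A^{\mathrm{perf}}$ is the full subcategory of perfect objects. The object $a$ is called *periodic* if it is not perfect and $a\cong\Sigma^n a$ in the Verdier quotient $\mathcal A/\mathcal A^{\mathrm{perf}}$ for some integer $n>0$. The *complexity* $\operatorname{cx}(a)\in\mathbb N_0\cup\{\infty\}$ is the least $s\in\mathbb N_0$ such that for every object $b$ of $\mathcal A$ there is $r_b\in\mathbb R$ such that, for all $n\in\mathbb Z$ with $|n|$ sufficiently large, the $H^0$-module $\operatorname{Hom}_{\mathcal A}(a,\Sigma^n b)$ can be generated by at most $r_b|n|^{s-1}$ elements; $\operatorname{cx}(a)=\infty$ if there is no such $s$. **Proposition.** Assume in addition that $H^0$ is a local ring. Then an object $a$ of $\mathcal A$ is periodic if and only if $\operatorname{cx}(a)=1$. -/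

import Mathlib

open CategoryTheory CategoryTheory.Limits CategoryTheory.MonoidalCategory
open CategoryTheory.Pretriangulated
open scoped CategoryTheory.MonoidalCategory.MonoidalLeftAction DirectSum

universe v₁ v₂ u₁ u₂ w

/-! ### Triangulated tensor categories and their actions -/

/-- Compatibility of a tensor product with the suspension `T = (-)⟦1⟧`: on a triangulated category
with an (additive) monoidal structure, this turns it into a triangulated tensor category. No
exactness of `⊗` is required. -/
class TriangulatedTensorCategory (C : Type u₁) [Category.{v₁} C] [Preadditive C]
    [HasShift C ℤ] [MonoidalCategory C] [MonoidalPreadditive C] where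
  /-- `lam x y : x ⊗ T y ≅ T (x ⊗ y)` -/
  lam (x y : C) : x ⊗ y⟦(1 : ℤ)⟧ ≅ (x ⊗ y)⟦(1 : ℤ)⟧
  /-- `rho x y : T x ⊗ y ≅ T (x ⊗ y)` -/
  rho (x y : C) : x⟦(1 : ℤ)⟧ ⊗ y ≅ (x ⊗ y)⟦(1 : ℤ)⟧
  lam_naturality {x x' y y' : C} (f : x ⟶ x') (g : y ⟶ y') :
    (f ⊗ₘ g⟦(1 : ℤ)⟧') ≫ (lam x' y').hom = (lam x y).hom ≫ (f ⊗ₘ g)⟦(1 : ℤ)⟧'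
  rho_naturality {x x' y y' : C} (f : x ⟶ x') (g : y ⟶ y') :
    (f⟦(1 : ℤ)⟧' ⊗ₘ g) ≫ (rho x' y').hom = (rho x y).hom ≫ (f ⊗ₘ g)⟦(1 : ℤ)⟧'
  lam_unit (x : C) :
    (lam (𝟙_ C) x).hom ≫ (λ_ x).hom⟦(1 : ℤ)⟧' = (λ_ (x⟦(1 : ℤ)⟧)).hom
  rho_unit (x : C) :
    (rho x (𝟙_ C)).hom ≫ (ρ_ x).hom⟦(1 : ℤ)⟧' = (ρ_ (x⟦(1 : ℤ)⟧)).hom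
  anticomm (x y : C) :
    (rho x (y⟦(1 : ℤ)⟧)).hom ≫ (lam x y).hom⟦(1 : ℤ)⟧' =
      -((lam (x⟦(1 : ℤ)⟧) y).hom ≫ (rho x y).hom⟦(1 : ℤ)⟧')

/-- An action of a triangulated tensor category `C` on a triangulated category `A`: an action of
the monoidal category `C` on `A` which is additive in each variable, together with natural
isomorphisms `lam : x * Σ a ≅ Σ (x * a)` and `rho : T x * a ≅ Σ (x * a)` such that `lam` is
compatible with the unit and the two identifications of `T x * Σ a` with `Σ² (x * a)` differ by
the sign `-1`. -/
class TriangulatedAction (C : Type u₁) [Category.{v₁} C] [Preadditive C] [HasShift C ℤ]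
    [MonoidalCategory C] (A : Type u₂) [Category.{v₂} A] [Preadditive A] [HasShift A ℤ]
    [MonoidalLeftAction C A] where
  add_actionHomLeft {x y : C} (f g : x ⟶ y) (a : A) : (f + g) ⊵ₗ a = f ⊵ₗ a + g ⊵ₗ a
  actionHomRight_add (x : C) {a b : A} (f g : a ⟶ b) : x ⊴ₗ (f + g) = x ⊴ₗ f + x ⊴ₗ g
  /-- `lam x a : x * Σ a ≅ Σ (x * a)` -/
  lam (x : C) (a : A) : x ⊙ₗ a⟦(1 : ℤ)⟧ ≅ (x ⊙ₗ a)⟦(1 : ℤ)⟧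
  /-- `rho x a : T x * a ≅ Σ (x * a)` -/
  rho (x : C) (a : A) : x⟦(1 : ℤ)⟧ ⊙ₗ a ≅ (x ⊙ₗ a)⟦(1 : ℤ)⟧
  lam_naturality {x x' : C} {a a' : A} (f : x ⟶ x') (g : a ⟶ a') :
    (f ⊙ₗₘ g⟦(1 : ℤ)⟧') ≫ (lam x' a').hom = (lam x a).hom ≫ (f ⊙ₗₘ g)⟦(1 : ℤ)⟧'
  rho_naturality {x x' : C} {a a' : A} (f : x ⟶ x') (g : a ⟶ a') :
    (f⟦(1 : ℤ)⟧' ⊙ₗₘ g) ≫ (rho x' a').hom = (rho x a).hom ≫ (f ⊙ₗₘ g)⟦(1 : ℤ)⟧'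
  lam_unit (a : A) :
    (lam (𝟙_ C) a).hom ≫ (λₗ[C] a).hom⟦(1 : ℤ)⟧' = (λₗ[C] (a⟦(1 : ℤ)⟧)).hom
  anticomm (x : C) (a : A) :
    (rho x (a⟦(1 : ℤ)⟧)).hom ≫ (lam x a).hom⟦(1 : ℤ)⟧' =
      -((lam (x⟦(1 : ℤ)⟧) a).hom ≫ (rho x a).hom⟦(1 : ℤ)⟧')

/-! ### Iterating a commutation isomorphism `F T ≅ Σ F` -/

namespace ShiftIterate

variable {C : Type u₁} [Category.{v₁} C] {A : Type u₂} [Category.{v₂} A]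
  [HasShift C ℤ] [HasShift A ℤ] (F : C ⥤ A)

/-- Isomorphisms `F Tⁿ ≅ Σⁿ F`. -/
abbrev Comm (n : ℤ) := shiftFunctor C n ⋙ F ≅ F ⋙ shiftFunctor A n

variable {F}

/-- From `e : F Tⁿ ≅ Σⁿ F`, the isomorphism `Σ⁻ⁿ (e⁻¹) : F T⁻ⁿ ≅ Σ⁻ⁿ F`. -/
noncomputable def neg {n : ℤ} (e : Comm F n) : Comm F (-n) :=
  NatIso.ofComponents
    (fun X => (shiftFunctorCompIsoId A n (-n) (add_neg_cancel n)).symm.app (F.obj (X⟦-n⟧)) ≪≫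
      (shiftFunctor A (-n)).mapIso (e.symm.app (X⟦-n⟧) ≪≫
        F.mapIso ((shiftFunctorCompIsoId C (-n) n (neg_add_cancel n)).app X)))
    (by
      intro X Y f
      have h1 := (shiftFunctorCompIsoId A n (-n) (add_neg_cancel n)).inv.naturality
        (F.map (f⟦-n⟧'))
      have h2 := e.inv.naturality (f⟦-n⟧')
      have h3 := (shiftFunctorCompIsoId C (-n) n (neg_add_cancel n)).hom.naturality f
      dsimp at h1 h2 h3 ⊢
      rw [reassoc_of% h1]
      simp only [Category.assoc, ← Functor.map_comp]
      rw [reassoc_of% h2, ← F.map_comp, h3, F.map_comp])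

lemma isoAdd'_neg {n : ℤ} (e : Comm F n) :
    Functor.CommShift.isoAdd' (neg_add_cancel n) (neg e) e = Functor.CommShift.isoZero F ℤ := by
  ext X
  have h1 : ((shiftFunctorCompIsoId A n (-n) (add_neg_cancel n)).inv.app (F.obj (X⟦-n⟧)))⟦n⟧' =
      (shiftFunctorCompIsoId A (-n) n (neg_add_cancel n)).inv.app ((F.obj (X⟦-n⟧))⟦n⟧) :=
    shift_shiftFunctorCompIsoId_add_neg_cancel_inv_app n _
  have h2 := fun {Y Z : A} (f : Y ⟶ Z) =>
    (shiftFunctorCompIsoId A (-n) n (neg_add_cancel n)).inv.naturality f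
  dsimp at h2
  have h3 : ((neg e).hom.app X)⟦n⟧' =
      e.inv.app (X⟦-n⟧) ≫ F.map ((shiftFunctorCompIsoId C (-n) n (neg_add_cancel n)).hom.app X) ≫
        (shiftFunctorCompIsoId A (-n) n (neg_add_cancel n)).inv.app (F.obj X) := by
    simp only [neg, NatIso.ofComponents_hom_app, Iso.trans_hom, Functor.mapIso_hom, Iso.symm_hom,
      Iso.app_hom, Functor.map_comp]
    erw [h1]
    rw [← Functor.map_comp, ← Functor.map_comp]
    erw [← h2]
    simp
  rw [Functor.CommShift.isoAdd'_hom_app, h3, Functor.CommShift.isoZero_hom_app]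
  simp only [shiftFunctorCompIsoId, Iso.trans_hom, Iso.trans_inv, Iso.symm_hom, Iso.symm_inv,
    NatTrans.comp_app, Functor.comp_obj, Functor.id_obj, Functor.map_comp, Category.assoc]
  erw [Iso.hom_inv_id_app_assoc, Iso.hom_inv_id_app]
  rw [← F.map_comp_assoc, Iso.hom_inv_id_app, F.map_id, Category.comp_id, Category.id_comp]

/-- The iterates `F Tᵖ ≅ Σᵖ F` of `e : F T ≅ Σ F` for `p ≥ 0`. -/
noncomputable def pow (e : Comm F 1) : ∀ p : ℕ, Comm F (p : ℤ)
  | 0 => Functor.CommShift.isoZero F ℤ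
  | p + 1 => Functor.CommShift.isoAdd' (by push_cast; rfl) (pow e p) e

/-- The iterates `F Tⁿ ≅ Σⁿ F` of `e : F T ≅ Σ F`, where `e₋ₙ = Σ⁻ⁿ (eₙ⁻¹)` for `n > 0`. -/
noncomputable def zpow (e : Comm F 1) : ∀ n : ℤ, Comm F n
  | .ofNat p => pow e p
  | .negSucc p => neg (pow e (p + 1))

variable (F) in
/-- All isomorphisms `F Tⁿ ≅ Σⁿ F` for all `n`; they form a group under composition. -/
def Total := Σ n : ℤ, Comm F n

/-- An isomorphism `F Tⁿ ≅ Σⁿ F` as an element of the group of all of them. -/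
def Total.mk (n : ℤ) (e : Comm F n) : Total F := ⟨n, e⟩

lemma Total.mk_isoAdd' {a b c : ℤ} (h : a + b = c) (e : Comm F a) (f : Comm F b) :
    Total.mk c (Functor.CommShift.isoAdd' h e f) =
      Total.mk (a + b) (Functor.CommShift.isoAdd e f) := by
  subst h
  rfl

noncomputable instance : Group (Total F) :=
  @Group.ofLeftAxioms _ ⟨fun x y => ⟨x.1 + y.1, Functor.CommShift.isoAdd x.2 y.2⟩⟩
    ⟨fun x => ⟨-x.1, neg x.2⟩⟩ ⟨⟨0, Functor.CommShift.isoZero F ℤ⟩⟩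
    (by
      rintro ⟨a, x⟩ ⟨b, y⟩ ⟨c, z⟩
      refine Eq.trans ?_ (Total.mk_isoAdd' (add_assoc a b c).symm x _)
      refine congrArg (Sigma.mk (a + b + c)) ?_
      exact Functor.CommShift.isoAdd'_assoc x y z rfl rfl rfl)
    (by
      rintro ⟨a, x⟩
      refine (Total.mk_isoAdd' (zero_add a) _ x).symm.trans ?_
      exact congrArg (Sigma.mk a) (Functor.CommShift.isoZero_isoAdd'_ x))
    (by
      rintro ⟨a, x⟩
      refine (Total.mk_isoAdd' (neg_add_cancel a) _ x).symm.trans ?_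
      exact congrArg (Sigma.mk 0) (isoAdd'_neg x))

lemma mk_pow (e : Comm F 1) (p : ℕ) :
    Total.mk p (pow e p) = Total.mk 1 e ^ p := by
  induction p with
  | zero => rfl
  | succ p ih =>
    rw [pow_succ, ← ih]
    exact Total.mk_isoAdd' _ _ _

lemma mk_zpow (e : Comm F 1) (n : ℤ) :
    Total.mk n (zpow e n) = Total.mk 1 e ^ n := by
  cases n with
  | ofNat p => exact (mk_pow e p).trans (zpow_natCast _ p).symm
  | negSucc p =>
    rw [zpow_negSucc, ← mk_pow]
    rfl

/-- The iterates of `F T ≅ Σ F` are coherent. -/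
@[reducible]
noncomputable def commShift (e : Comm F 1) : F.CommShift ℤ where
  commShiftIso := zpow e
  commShiftIso_zero := rfl
  commShiftIso_add a b := by
    have h : Total.mk (a + b) (zpow e (a + b)) =
        Total.mk (a + b) (Functor.CommShift.isoAdd (zpow e a) (zpow e b)) := by
      rw [mk_zpow, zpow_add, ← mk_zpow, ← mk_zpow]
      rfl
    exact eq_of_heq (Sigma.mk.inj h).2

lemma zpow_one (e : Comm F 1) : zpow e 1 = e :=
  Functor.CommShift.isoZero_isoAdd'_ (F := F) e

end ShiftIterate

/-! ### Graded homomorphism groups -/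

section GradedHom

variable {A : Type u₂} [Category.{v₂} A] [HasShift A ℤ]

/-- The degree `n` part `Hom(a, Σⁿ b)` of `Hom^*(a, b)`. -/
def HomFam (a b : A) (n : ℤ) : Type v₂ := ShiftedHom a b n

instance [Preadditive A] (a b : A) (n : ℤ) : AddCommGroup (HomFam a b n) :=
  inferInstanceAs (AddCommGroup (a ⟶ b⟦n⟧))

/-- For `η : b ⟶ Σᵖ c` and `f : a ⟶ Σ^q b`, the product `η f` is `Σ^q(η) ∘ f`. -/
noncomputable def HomFam.mul {a b c : A} {p q : ℤ} (η : HomFam b c p) (f : HomFam a b q) :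
    HomFam a c (p + q) :=
  ShiftedHom.comp (X := a) (Y := b) (Z := c) f η rfl

lemma HomFam.mk_comp {a b c : A} {p q r : ℤ} (h : p + q = r) (η : HomFam b c p)
    (f : HomFam a b q) :
    GradedMonoid.mk (A := HomFam a c) r (ShiftedHom.comp (X := a) (Y := b) (Z := c) f η h) =
      GradedMonoid.mk (p + q) (HomFam.mul η f) := by
  subst h
  rfl

lemma HomFam.one_mul' {a b : A} {p : ℤ} (f : HomFam a b p) :
    GradedMonoid.mk (A := HomFam a b) (0 + p)
      (HomFam.mul (ShiftedHom.mk₀ (X := b) 0 rfl (𝟙 b) : HomFam b b 0) f) =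
        GradedMonoid.mk p f := by
  refine (HomFam.mk_comp (zero_add p) _ f).symm.trans ?_
  exact congrArg (GradedMonoid.mk p) (ShiftedHom.comp_mk₀_id (X := a) (Y := b) f 0 rfl)

lemma HomFam.mul_one' {a b : A} {p : ℤ} (f : HomFam a b p) :
    GradedMonoid.mk (A := HomFam a b) (p + 0)
      (HomFam.mul f (ShiftedHom.mk₀ (X := a) 0 rfl (𝟙 a) : HomFam a a 0)) =
        GradedMonoid.mk p f := by
  refine (HomFam.mk_comp (add_zero p) f _).symm.trans ?_
  exact congrArg (GradedMonoid.mk p) (ShiftedHom.mk₀_id_comp (X := a) (Y := b) 0 rfl f)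

lemma HomFam.mul_assoc' {a b c d : A} {p q r : ℤ} (η : HomFam c d p) (θ : HomFam b c q)
    (f : HomFam a b r) :
    GradedMonoid.mk (A := HomFam a d) (p + q + r) (HomFam.mul (HomFam.mul η θ) f) =
      GradedMonoid.mk (p + (q + r)) (HomFam.mul η (HomFam.mul θ f)) := by
  refine Eq.trans ?_ (HomFam.mk_comp (add_assoc p q r).symm η (HomFam.mul θ f))
  refine congrArg (GradedMonoid.mk (p + q + r)) ?_
  exact (ShiftedHom.comp_assoc (X := a) (Y := b) (Z := c) (T := d) f θ η rfl rfl rfl).symm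

noncomputable instance (a : A) : GradedMonoid.GMul (HomFam a a) where
  mul η θ := HomFam.mul η θ

noncomputable instance (a : A) : GradedMonoid.GOne (HomFam a a) where
  one := ShiftedHom.mk₀ (X := a) 0 rfl (𝟙 a)

noncomputable instance (a : A) : GradedMonoid.GMonoid (HomFam a a) where
  one_mul f := HomFam.one_mul' f.2
  mul_one f := HomFam.mul_one' f.2
  mul_assoc f g h := HomFam.mul_assoc' f.2 g.2 h.2

variable [Preadditive A] [∀ n : ℤ, (shiftFunctor A n).Additive]

noncomputable instance (a : A) : DirectSum.GRing (HomFam a a) where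
  mul_zero f := ShiftedHom.zero_comp (X := a) (Y := a) (Z := a) _ f rfl
  zero_mul f := ShiftedHom.comp_zero (X := a) (Y := a) (Z := a) f rfl
  mul_add f g h := ShiftedHom.add_comp (X := a) (Y := a) (Z := a) g h f rfl
  add_mul f g h := ShiftedHom.comp_add (X := a) (Y := a) (Z := a) h f g rfl
  natCast n := n • (ShiftedHom.mk₀ (X := a) 0 rfl (𝟙 a) : ShiftedHom a a (0 : ℤ))
  natCast_zero := zero_nsmul _
  natCast_succ n := succ_nsmul _ n
  intCast n := n • (ShiftedHom.mk₀ (X := a) 0 rfl (𝟙 a) : ShiftedHom a a (0 : ℤ))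
  intCast_ofNat n := natCast_zsmul _ n
  intCast_negSucc_ofNat n := negSucc_zsmul _ n

noncomputable instance (a b : A) : DirectSum.Gmodule (HomFam b b) (HomFam a b) where
  smul η f := HomFam.mul η f
  one_smul f := HomFam.one_mul' f.2
  mul_smul f g h := HomFam.mul_assoc' f.2 g.2 h.2
  smul_add f g h := ShiftedHom.add_comp (X := a) (Y := b) (Z := b) g h f rfl
  smul_zero f := ShiftedHom.zero_comp (X := a) (Y := b) (Z := b) _ f rfl
  add_smul f g h := ShiftedHom.comp_add (X := a) (Y := b) (Z := b) h f g rfl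
  zero_smul f := ShiftedHom.comp_zero (X := a) (Y := b) (Z := b) f rfl

/-- The graded endomorphism ring `End^*(a) = ⨁ₚ Hom(a, Σᵖ a)`. -/
abbrev GradedEnd (a : A) : Type v₂ := ⨁ p : ℤ, HomFam a a p

end GradedHom

/-! ### The ring homomorphism `End^*(e) → End^*(a)` -/

section Conj

variable {A : Type u₂} [Category.{v₂} A] [HasShift A ℤ]

/-- Transport of `f : x ⟶ Σᵖ x` along an isomorphism `i : x ≅ y`. -/
noncomputable def shiftedConj {x y : A} (i : x ≅ y) {p : ℤ} (f : ShiftedHom x x p) :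
    ShiftedHom y y p :=
  i.inv ≫ f ≫ i.hom⟦p⟧'

lemma shiftedConj_add [Preadditive A] {x y : A} (i : x ≅ y) {p : ℤ} (f g : ShiftedHom x x p) :
    shiftedConj i (f + g) = shiftedConj i f + shiftedConj i g := by
  simp [shiftedConj]

lemma shiftedConj_one {x y : A} (i : x ≅ y) :
    shiftedConj i (ShiftedHom.mk₀ (0 : ℤ) rfl (𝟙 x)) = ShiftedHom.mk₀ (0 : ℤ) rfl (𝟙 y) := by
  have h := (shiftFunctorZero A ℤ).inv.naturality i.hom
  dsimp at h
  simp [shiftedConj, ShiftedHom.mk₀, shiftFunctorZero', ← h]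

lemma shiftedConj_comp {x y : A} (i : x ≅ y) {p q r : ℤ} (hr : p + q = r)
    (g : ShiftedHom x x p) (f : ShiftedHom x x q) :
    shiftedConj i (f.comp g hr) = (shiftedConj i f).comp (shiftedConj i g) hr := by
  have hn := (shiftFunctorAdd' A p q r hr).inv.naturality i.hom
  dsimp at hn
  simp only [shiftedConj, ShiftedHom.comp, Category.assoc, Functor.map_comp]
  rw [← hn, ← (shiftFunctor A q).map_comp_assoc i.hom i.inv, Iso.hom_inv_id,
    CategoryTheory.Functor.map_id, Category.id_comp]

end Conj

section Phi

variable {C : Type u₁} [Category.{v₁} C] [Preadditive C] [HasShift C ℤ] [MonoidalCategory C]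
  {A : Type u₂} [Category.{v₂} A] [Preadditive A] [HasShift A ℤ] [MonoidalLeftAction C A]
  [TriangulatedAction C A]

variable (C) in
/-- The functor `- * a : C ⥤ A`. -/
abbrev actFunctor (a : A) : C ⥤ A := (MonoidalLeftAction.curriedAction C A).flip.obj a

variable (C) in
/-- The isomorphism of functors `T(-) * a ≅ Σ(- * a)`. -/
noncomputable def actRho (a : A) : ShiftIterate.Comm (actFunctor C a) 1 :=
  NatIso.ofComponents (fun x => TriangulatedAction.rho x a) (by
    intro x y f
    have h := TriangulatedAction.rho_naturality f (𝟙 a)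
    simp only [MonoidalLeftAction.actionHom_id] at h
    exact h)

/-- The isomorphisms `ρₙ : Tⁿ(-) * a ≅ Σⁿ(- * a)`, for all integers `n`. -/
noncomputable instance (a : A) : (actFunctor C a).CommShift ℤ :=
  ShiftIterate.commShift (actRho C a)

instance (a : A) : (actFunctor C a).Additive where
  map_add {_ _ f g} := TriangulatedAction.add_actionHomLeft f g a

variable (C) in
/-- The isomorphism `e * a ≅ a`. -/
abbrev actUnit (a : A) : (actFunctor C a).obj (𝟙_ C) ≅ a := λₗ[C] a

/-- For `h : e ⟶ Tᵖ e`, the morphism `a ≅ e * a ⟶ Tᵖ e * a ≅ Σᵖ (e * a) ≅ Σᵖ a`. -/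
noncomputable def phiHom (a : A) {p : ℤ} (h : ShiftedHom (𝟙_ C) (𝟙_ C) p) : ShiftedHom a a p :=
  shiftedConj (actUnit C a) (h.map (actFunctor C a))

lemma phiHom_add (a : A) {p : ℤ} (h h' : ShiftedHom (𝟙_ C) (𝟙_ C) p) :
    phiHom a (h + h') = phiHom a h + phiHom a h' := by
  rw [phiHom, ShiftedHom.map_add, shiftedConj_add]
  rfl

lemma phiHom_one (a : A) :
    phiHom a (ShiftedHom.mk₀ (0 : ℤ) rfl (𝟙 (𝟙_ C))) = ShiftedHom.mk₀ (0 : ℤ) rfl (𝟙 a) := by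
  rw [phiHom, ShiftedHom.map_mk₀, (actFunctor C a).map_id, shiftedConj_one]

lemma phiHom_mul (a : A) {p q r : ℤ} (hr : p + q = r) (h : ShiftedHom (𝟙_ C) (𝟙_ C) p)
    (h' : ShiftedHom (𝟙_ C) (𝟙_ C) q) :
    phiHom a (h'.comp h hr) = (phiHom a h').comp (phiHom a h) hr := by
  rw [phiHom, ShiftedHom.map_comp, shiftedConj_comp]
  rfl

/-- `phiHom` on the degree `p` part of the graded endomorphism ring. -/
noncomputable def phiFam (a : A) (p : ℤ) (h : HomFam (𝟙_ C) (𝟙_ C) p) : HomFam a a p :=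
  phiHom (C := C) a (p := p) h

variable [∀ n : ℤ, (shiftFunctor C n).Additive] [∀ n : ℤ, (shiftFunctor A n).Additive]

variable (C) in
/-- The homomorphism of graded rings `φ_a : End^*(e) → End^*(a)`. -/
noncomputable def phi (a : A) : GradedEnd (𝟙_ C) →+* GradedEnd a :=
  DirectSum.toSemiring
    (fun p => (DirectSum.of (HomFam a a) p).comp (AddMonoidHom.mk' (phiFam a p) (phiHom_add a)))
    (congrArg (DirectSum.of (HomFam a a) 0) (phiHom_one (C := C) a))
    (fun h h' => (congrArg (DirectSum.of (HomFam a a) _) (phiHom_mul (C := C) a rfl h h')).trans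
      (DirectSum.of_mul_of _ _).symm)

end Phi

/-! ### Graded-commutative rings, homogeneous primes, supports -/

section Graded

variable {H : Type w} [Ring H] (𝒜 : ℕ → AddSubgroup H)

/-- Graded-commutativity: `x y = (-1)^(|x| |y|) y x` for homogeneous elements. -/
def IsGradedCommutative : Prop :=
  ∀ (p q : ℕ) (x y : H), x ∈ 𝒜 p → y ∈ 𝒜 q → x * y = (-1) ^ (p * q) * (y * x)

variable [GradedRing 𝒜]

/-- The degree zero part `H⁰`. -/
abbrev degreeZero : Subring H := SetLike.GradeZero.subring 𝒜

/-- `Spec H`: the homogeneous prime ideals. In a graded-commutative ring homogeneous left ideals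
are two-sided, and all usual notions of primeness agree for them. -/
structure HomogeneousSpec where
  toIdeal : Ideal H
  isHomogeneous : toIdeal.IsHomogeneous 𝒜
  isPrime : toIdeal.IsPrime

/-- `{𝔭 ∈ Spec H ∣ M_𝔭 ≠ 0}`, where `M_𝔭` inverts the homogeneous elements outside `𝔭`. (As such
elements commute with all homogeneous elements up to sign, `m ∈ M` vanishes in `M_𝔭` if and only
if it is annihilated by one of them.) -/
def gradedSupport (M : Type*) [AddCommGroup M] [Module H M] : Set (HomogeneousSpec 𝒜) :=
  {𝔭 | ∃ m : M, ∀ (i : ℕ) (s : H), s ∈ 𝒜 i → s ∉ 𝔭.toIdeal → s • m ≠ 0}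

/-- `V(I) = Supp (H/I)` for a homogeneous ideal `I`. -/
def idealVariety (I : Ideal H) : Set (HomogeneousSpec 𝒜) := gradedSupport 𝒜 (H ⧸ I)

/-- The ideal `H⁺` generated by the nilradical of `H⁰` and by the elements of positive degree. -/
def positiveIdeal : Ideal H :=
  Ideal.span ({x | x ∈ 𝒜 0 ∧ IsNilpotent x} ∪ {x | ∃ i : ℕ, 1 ≤ i ∧ x ∈ 𝒜 i})

end Graded

/-! ### Support varieties, complexity, perfect and periodic objects -/

/-- A homomorphism of graded rings `H → End^*(e)` to the graded endomorphism ring of the tensor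
identity, where `H = ⨁_{i ≥ 0} 𝒜 i`. -/
structure GradedHomToEnd (C : Type u₁) [Category.{v₁} C] [Preadditive C] [HasShift C ℤ]
    [∀ n : ℤ, (shiftFunctor C n).Additive] [MonoidalCategory C]
    {H : Type w} [Ring H] (𝒜 : ℕ → AddSubgroup H) where
  toRingHom : H →+* GradedEnd (𝟙_ C)
  map_mem : ∀ (i : ℕ) (x : H), x ∈ 𝒜 i →
    ∃ g : HomFam (𝟙_ C) (𝟙_ C) (i : ℤ), toRingHom x = DirectSum.of (HomFam (𝟙_ C) (𝟙_ C)) (i : ℤ) g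

section Main

variable {C : Type u₁} [Category.{v₁} C] [Preadditive C] [HasShift C ℤ]
  [∀ n : ℤ, (shiftFunctor C n).Additive] [MonoidalCategory C]
  {A : Type u₂} [Category.{v₂} A] [Preadditive A] [HasShift A ℤ]
  [∀ n : ℤ, (shiftFunctor A n).Additive] [MonoidalLeftAction C A] [TriangulatedAction C A]
  {H : Type w} [Ring H] {𝒜 : ℕ → AddSubgroup H}

/-- `Hom^*(a, b) = ⨁ₚ Hom(a, Σᵖ b)`, as a left `H`-module via `H → End^*(e) → End^*(b)`. -/
def HomStar (_φ : GradedHomToEnd C 𝒜) (a b : A) : Type v₂ := ⨁ p : ℤ, HomFam a b p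

noncomputable instance (φ : GradedHomToEnd C 𝒜) (a b : A) : AddCommGroup (HomStar φ a b) :=
  inferInstanceAs (AddCommGroup (⨁ p : ℤ, HomFam a b p))

noncomputable instance (φ : GradedHomToEnd C 𝒜) (a b : A) : Module H (HomStar φ a b) :=
  letI : Module (GradedEnd b) (HomStar φ a b) :=
    inferInstanceAs (Module (⨁ p : ℤ, HomFam b b p) (⨁ p : ℤ, HomFam a b p))
  Module.compHom (HomStar φ a b) ((phi C b).comp φ.toRingHom)

/-- The element of `Hom^*(a, b)` given by `f : a ⟶ Σⁿ b`. -/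
noncomputable def HomStar.of (φ : GradedHomToEnd C 𝒜) (a b : A) (n : ℤ) :
    HomFam a b n →+ HomStar φ a b :=
  DirectSum.of (HomFam a b) n

lemma HomStar.smul_of (φ : GradedHomToEnd C 𝒜) (a b : A) {i : ℕ} {x : H} {n : ℤ}
    {g : HomFam (𝟙_ C) (𝟙_ C) (i : ℤ)}
    (hg : φ.toRingHom x = DirectSum.of (HomFam (𝟙_ C) (𝟙_ C)) (i : ℤ) g) (f : HomFam a b n) :
    x • HomStar.of φ a b n f = HomStar.of φ a b (i + n) (HomFam.mul (phiFam b i g) f) := by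
  have h : phi C b (φ.toRingHom x) = DirectSum.of (HomFam b b) (i : ℤ) (phiFam b i g) := by
    rw [hg]
    exact DirectSum.toSemiring_of _ _ _ _ _
  change (phi C b (φ.toRingHom x)) • (DirectSum.of (HomFam a b) n f) = _
  rw [h]
  exact DirectSum.Gmodule.of_smul_of _ _ _ _

variable [GradedRing 𝒜]

/-- `Hom(a, Σⁿ b)` as an `H⁰`-submodule of `Hom^*(a, b)`. -/
noncomputable def homDegree (φ : GradedHomToEnd C 𝒜) (a b : A) (n : ℤ) :
    Submodule (degreeZero 𝒜) (HomStar φ a b) where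
  toAddSubmonoid := (HomStar.of φ a b n).range.toAddSubmonoid
  smul_mem' := by
    rintro ⟨r, hr⟩ _ ⟨f, rfl⟩
    obtain ⟨g, hg⟩ := φ.map_mem 0 r hr
    have h := HomStar.smul_of φ a b hg f
    have e : ((0 : ℕ) : ℤ) + n = n := by simp
    have h' : ∀ {m : ℤ} (_ : m = n) (f' : HomFam a b m),
        HomStar.of φ a b m f' ∈ (HomStar.of φ a b n).range := by
      rintro m rfl f'
      exact ⟨f', rfl⟩
    change r • HomStar.of φ a b n f ∈ (HomStar.of φ a b n).range
    rw [h]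
    exact h' e _

/-- The minimal number of generators of the `H⁰`-module `Hom(a, Σⁿ b)`. -/
noncomputable def mingen (φ : GradedHomToEnd C 𝒜) (a b : A) (n : ℤ) : ℕ :=
  (homDegree φ a b n).spanFinrank

/-- For every `b` there is `r` such that `Hom(a, Σⁿ b)` has at most `r |n|^(s-1)` generators over
`H⁰` for all `n` with `|n|` large. -/
def HasGrowth (φ : GradedHomToEnd C 𝒜) (a : A) (s : ℕ) : Prop :=
  ∀ b : A, ∃ (r : ℝ) (N : ℕ), ∀ n : ℤ, (N : ℤ) ≤ |n| →
    (mingen φ a b n : ℝ) ≤ r * (|n| : ℝ) ^ ((s : ℤ) - 1)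

/-- The complexity of `a`: the least `s` as in `HasGrowth`, and `∞` if there is none. -/
noncomputable def complexity (φ : GradedHomToEnd C 𝒜) (a : A) : ℕ∞ :=
  ⨅ (s : ℕ) (_ : HasGrowth φ a s), (s : ℕ∞)

/-- The support variety `V(a) = Supp Hom^*(a, a)`. -/
def supportVariety (φ : GradedHomToEnd C 𝒜) (a : A) : Set (HomogeneousSpec 𝒜) :=
  gradedSupport 𝒜 (HomStar φ a a)

/-- The perfect objects: `V(a) ⊆ V(H⁺)`. -/
def perfectObjects (φ : GradedHomToEnd C 𝒜) : ObjectProperty A := fun a =>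
  supportVariety φ a ⊆ idealVariety 𝒜 (positiveIdeal 𝒜)

variable [HasZeroObject A] [Pretriangulated A]

/-- The Verdier quotient `A/A^perf`: the localization of `A` at the morphisms whose cone is
perfect. -/
abbrev PerfQuotient (φ : GradedHomToEnd C 𝒜) (A : Type u₂) [Category.{v₂} A] [Preadditive A]
    [HasShift A ℤ] [∀ n : ℤ, (shiftFunctor A n).Additive] [MonoidalLeftAction C A]
    [TriangulatedAction C A] [HasZeroObject A] [Pretriangulated A] :=
  (perfectObjects (A := A) φ).trW.Localization

/-- The quotient functor `A ⥤ A/A^perf`. -/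
noncomputable abbrev perfQuotientFunctor (φ : GradedHomToEnd C 𝒜) : A ⥤ PerfQuotient φ A :=
  (perfectObjects (A := A) φ).trW.Q

/-- `a` is periodic: it is not perfect and `a ≅ Σⁿ a` in `A/A^perf` for some `n > 0`. -/
def IsPeriodicObject (φ : GradedHomToEnd C 𝒜) (a : A) : Prop :=
  ¬ perfectObjects φ a ∧ ∃ n : ℕ, 0 < n ∧
    Nonempty ((perfQuotientFunctor φ).obj a ≅ (perfQuotientFunctor φ).obj (a⟦(n : ℤ)⟧))

end Main

/-! Write `N i` for the `H⁰`-module `Hom(a, Σⁱ b)`. Finite generation of `Hom^*(a, b)` over a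
Noetherian ring living in degrees `≥ 0` makes each `N i` finitely generated over `H⁰` and zero for
`i ≪ 0`, so only large `i` matter.

Perfect means complexity zero. A support argument shows that `a` is perfect iff `Hom(a, Σⁿ a) = 0`
for `n ≫ 0` (`perfectObjects_iff`). Then elements of `H` of high degree act as zero on `a`, hence
kill `Hom^*(a, b)` for every `b`, and `Hom(a, Σⁿ b)` vanishes for `n ≫ 0` too
(`eventually_hom_eq_zero`). It remains to compare periodicity with boundedness of the numbers of
generators.

Periodic implies bounded. By the long exact sequence, the family `n ↦ Hom(-, Σⁿ b)`, taken up to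
equality in high degrees, inverts morphisms with perfect cone, so it factors through the Verdier
quotient. An isomorphism `a ≅ Σⁿ a` there makes the numbers of generators eventually periodic
(`hasGrowth_one_of_iso_shift`).

Bounded implies periodic. The core is `exists_central_of_bounded`: if the numbers of generators of
the `N i` (with `b = a`) are bounded, one central homogeneous `z` of degree `D ≥ 1` satisfies `N i =
z N (i - D)` for `i ≫ 0`. Indeed, modulo the maximal ideal of `H⁰` the many monomials in two
operators `x`, `y` must satisfy a relation; it lets one operator replace both, and Nakayama removes
the maximal ideal. By Noetherianity `z` is also injective in high degrees. Its action is a morphism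
`g : a ⟶ Σᴰ a` inducing bijections on `Hom(a, Σⁱ -)` for `i ≫ 0`, so the cone of `g` has no
self-extensions in high degrees. The cone is perfect and `g` becomes invertible in the quotient
(`exists_iso_shift_of_hasGrowth_one`). -/

set_option linter.unusedSectionVars false

/-! ### Eventual generation of graded modules -/


section ShiftImage

variable {R S M : Type*} [CommRing R] [Ring S] [Algebra R S] [AddCommGroup M] [Module R M]
  [Module S M] [IsScalarTower R S M]

lemma Filter.Eventually.int_sub {P : ℤ → Prop} (h : ∀ᶠ i in Filter.atTop, P i) (c : ℤ) :
    ∀ᶠ i in Filter.atTop, P (i - c) :=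
  (Filter.tendsto_atTop_add_const_right _ (-c) Filter.tendsto_id).eventually h

/-- The family `i ↦ x • N (i - d)`. -/
def shiftImage (N : ℤ → Submodule R M) (x : S) (d : ℕ) (i : ℤ) : Submodule R M :=
  (N (i - d)).map (Algebra.lsmul R R M x)

lemma mem_shiftImage {N : ℤ → Submodule R M} {x : S} {d : ℕ} {i : ℤ} {m : M} :
    m ∈ shiftImage N x d i ↔ ∃ u ∈ N (i - d), x • u = m := Iff.rfl

/-- `x` maps `W i` to `W (i + d)`. -/
def ShiftsBy (W : ℤ → Submodule R M) (x : S) (d : ℕ) : Prop :=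
  ∀ i, ∀ m ∈ W i, x • m ∈ W (i + d)

lemma ShiftsBy.pow {W : ℤ → Submodule R M} {x : S} {d : ℕ} (h : ShiftsBy W x d) (e : ℕ) :
    ShiftsBy W (x ^ e) (e * d) := by
  induction e with
  | zero => intro i m hm; simpa using hm
  | succ e ih =>
    intro i m hm
    have := h _ _ (ih i m hm)
    rw [pow_succ', mul_smul]
    convert this using 1
    push_cast
    ring_nf

/-- Substitute the inclusion into itself: `N ⊆ xN + W ⊆ x(xN + W) + W`, and `xW ⊆ W`. Each
substitution shifts the degree from which the inclusion holds, which the eventual formulation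
absorbs. -/
lemma eventually_le_shiftImage_pow {N W : ℤ → Submodule R M} {x : S} {d : ℕ}
    (hW : ShiftsBy W x d)
    (h : ∀ᶠ i in Filter.atTop, N i ≤ shiftImage N x d i ⊔ W i) (e : ℕ) :
    ∀ᶠ i in Filter.atTop, N i ≤ shiftImage N (x ^ e) (e * d) i ⊔ W i := by
  induction e with
  | zero =>
    refine Filter.Eventually.of_forall fun i => le_sup_of_le_left fun m hm => ?_
    exact mem_shiftImage.2 ⟨m, by simpa using hm, by simp⟩
  | succ e ih =>
    filter_upwards [ih, h.int_sub (e * d : ℕ)] with i hi hi'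
    intro m hm
    obtain ⟨_, ⟨u, hu, rfl⟩, w, hw, rfl⟩ := Submodule.mem_sup.1 (hi hm)
    obtain ⟨_, ⟨v, hv, rfl⟩, w', hw', rfl⟩ := Submodule.mem_sup.1 (hi' hu)
    simp only [Algebra.lsmul_coe]
    rw [smul_add, add_assoc]
    refine Submodule.add_mem_sup (mem_shiftImage.2 ⟨v, ?_, ?_⟩) (add_mem ?_ hw)
    · rw [SetLike.mem_coe] at hv
      convert hv using 2
      push_cast
      ring
    · rw [pow_succ, mul_smul]
    · have := hW.pow e _ _ hw'
      rwa [sub_add_cancel] at this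

/-- The family `i ↦ ∑ x • N (i - d)`, where `(d, x)` runs through a list. -/
def sumImage (N : ℤ → Submodule R M) : List (ℕ × S) → ℤ → Submodule R M
  | [], _ => ⊥
  | p :: L, i => shiftImage N p.2 p.1 i ⊔ sumImage N L i

lemma shiftImage_le_sumImage (N : ℤ → Submodule R M) {L : List (ℕ × S)} {p : ℕ × S} (hp : p ∈ L)
    (i : ℤ) : shiftImage N p.2 p.1 i ≤ sumImage N L i := by
  induction L with
  | nil => simp at hp
  | cons q L ih =>
    rcases List.mem_cons.1 hp with rfl | hp
    · exact le_sup_left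
    · exact (ih hp).trans le_sup_right

lemma ShiftsBy.sup {W W' : ℤ → Submodule R M} {x : S} {d : ℕ} (h : ShiftsBy W x d)
    (h' : ShiftsBy W' x d) : ShiftsBy (fun i => W i ⊔ W' i) x d := by
  intro i m hm
  obtain ⟨u, hu, w, hw, rfl⟩ := Submodule.mem_sup.1 hm
  rw [smul_add]
  exact Submodule.add_mem_sup (h _ _ hu) (h' _ _ hw)

lemma ShiftsBy.shiftImage {N : ℤ → Submodule R M} {x y : S} {d e : ℕ} (h : ShiftsBy N x d)
    (hc : x * y = y * x ∨ x * y = -(y * x)) : ShiftsBy (shiftImage N y e) x d := by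
  intro i m hm
  obtain ⟨u, hu, rfl⟩ := mem_shiftImage.1 hm
  have h1 : x • u ∈ N (i + d - e) := by
    convert h _ _ hu using 2
    ring
  rw [smul_smul]
  rcases hc with hc | hc
  · exact mem_shiftImage.2 ⟨x • u, h1, by rw [smul_smul, hc]⟩
  · exact mem_shiftImage.2 ⟨-(x • u), neg_mem h1, by rw [smul_neg, smul_smul, hc, neg_smul]⟩

lemma ShiftsBy.sumImage {N : ℤ → Submodule R M} {x : S} {d : ℕ} (h : ShiftsBy N x d)
    (L : List (ℕ × S)) (hc : ∀ p ∈ L, x * p.2 = p.2 * x ∨ x * p.2 = -(p.2 * x)) :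
    ShiftsBy (sumImage N L) x d := by
  induction L with
  | nil =>
    intro i m hm
    rw [(Submodule.mem_bot R).1 hm, smul_zero]
    exact zero_mem _
  | cons p L ih =>
    exact ShiftsBy.sup (h.shiftImage (hc p (by simp)))
      (ih fun q hq => hc q (List.mem_cons_of_mem _ hq))

lemma mul_pow_eq_or_eq_neg {x y : S} (h : x * y = y * x ∨ x * y = -(y * x)) (e : ℕ) :
    x * y ^ e = y ^ e * x ∨ x * y ^ e = -(y ^ e * x) := by
  induction e with
  | zero => simp
  | succ e ih =>
    rw [pow_succ, ← mul_assoc]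
    rcases ih with ih | ih <;> rcases h with h | h <;>
      simp [ih, mul_assoc, h]

/-- In a generating set of operators which commute up to sign, each of them can be replaced by a
power. -/
lemma eventually_le_sumImage_pow {N : ℤ → Submodule R M} (e : ℕ) (L : List (ℕ × S))
    (hN : ∀ p ∈ L, ShiftsBy N p.2 p.1)
    (hc : ∀ p ∈ L, ∀ q ∈ L, p.2 * q.2 = q.2 * p.2 ∨ p.2 * q.2 = -(q.2 * p.2))
    (W : ℤ → Submodule R M) (hW : ∀ p ∈ L, ShiftsBy W p.2 p.1)
    (h : ∀ᶠ i in Filter.atTop, N i ≤ sumImage N L i ⊔ W i) :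
    ∀ᶠ i in Filter.atTop,
      N i ≤ sumImage N (L.map fun p => (e * p.1, p.2 ^ e)) i ⊔ W i := by
  induction L generalizing W with
  | nil => exact h
  | cons p L ih =>
    -- Treat the images of all other operators as part of `W`; commutation up to sign makes this
    -- enlarged family stable under `p.2`.
    have h1 : ∀ᶠ i in Filter.atTop, N i ≤ shiftImage N p.2 p.1 i ⊔ (sumImage N L i ⊔ W i) := by
      filter_upwards [h] with i hi
      rw [← sup_assoc]
      exact hi
    have h2 := eventually_le_shiftImage_pow
      (ShiftsBy.sup ((hN p (by simp)).sumImage L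
        fun q hq => hc p (by simp) q (List.mem_cons_of_mem _ hq)) (hW p (by simp))) h1 e
    have h3 := ih (fun q hq => hN q (List.mem_cons_of_mem _ hq))
      (fun q hq q' hq' => hc q (List.mem_cons_of_mem _ hq) q' (List.mem_cons_of_mem _ hq'))
      (fun i => shiftImage N (p.2 ^ e) (e * p.1) i ⊔ W i)
      (fun q hq => ShiftsBy.sup ((hN q (List.mem_cons_of_mem _ hq)).shiftImage
        (mul_pow_eq_or_eq_neg (hc q (List.mem_cons_of_mem _ hq) p (by simp)) e))
        (hW q (List.mem_cons_of_mem _ hq)))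
      (by
        filter_upwards [h2] with i hi
        exact hi.trans (le_of_eq (by rw [sup_left_comm])))
    filter_upwards [h3] with i hi
    refine hi.trans (le_of_eq ?_)
    change _ = (shiftImage N (p.2 ^ e) (e * p.1) i ⊔ _) ⊔ _
    rw [sup_assoc, sup_left_comm]

lemma ShiftsBy.smul {N : ℤ → Submodule R M} {x : S} {d : ℕ} (h : ShiftsBy N x d) (I : Ideal R) :
    ShiftsBy (fun i => I • N i) x d := by
  intro i m hm
  induction hm using Submodule.smul_induction_on' with
  | smul r hr n hn =>
    rw [smul_comm]
    exact Submodule.smul_mem_smul hr (h _ _ hn)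
  | add a _ b _ ha hb =>
    rw [smul_add]
    exact add_mem ha hb

end ShiftImage

/-! ### Bounded growth over a local ring -/

/-- A linear relation modulo the maximal ideal between more vectors than coordinates. -/
lemma IsLocalRing.exists_relation_mod_maximalIdeal {R ι κ : Type*} [CommRing R] [IsLocalRing R]
    [Fintype ι] [Fintype κ] (h : Fintype.card κ < Fintype.card ι) (A : ι → κ → R) :
    ∃ c : ι → R, (∃ i, c i ∉ maximalIdeal R) ∧ ∀ k, ∑ i, c i * A i k ∈ maximalIdeal R := by
  have h1 : ¬ LinearIndependent (ResidueField R) fun i k => residue R (A i k) := by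
    intro hli
    have := hli.fintype_card_le_finrank
    rw [Module.finrank_fintype_fun_eq_card] at this
    omega
  obtain ⟨g, hg, i, hi⟩ := Fintype.not_linearIndependent_iff.1 h1
  choose c hc using fun i => residue_surjective (R := R) (g i)
  refine ⟨c, ⟨i, fun hm => hi ?_⟩, fun k => ?_⟩
  · rw [← hc, residue_eq_zero_iff]
    exact hm
  · rw [← residue_eq_zero_iff, map_sum]
    have := congrFun hg k
    simpa [hc] using this

section BoundedGrowth

open IsLocalRing

variable {R S M : Type*} [CommRing R] [IsLocalRing R] [CommRing S] [Algebra R S] [AddCommGroup M]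
  [Module R M] [Module S M] [IsScalarTower R S M]

/-- A family of submodules, acted upon by homogeneous operators, whose finitely many generators
`g j` detect whether an operator is zero modulo the maximal ideal. -/
structure IsDetecting (N : ℤ → Submodule R M) (B : ℕ → Submodule R S) {s : ℕ} (e : Fin s → ℤ)
    (g : Fin s → M) : Prop where
  shiftsBy : ∀ d, ∀ x ∈ B d, ShiftsBy N x d
  fg : ∀ i, (N i).FG
  mem : ∀ j, g j ∈ N (e j)
  detect : ∀ d, ∀ p ∈ B d, (∀ j, p • g j ∈ maximalIdeal R • N (e j + d)) →
    ∀ i, ∀ m ∈ N i, p • m ∈ maximalIdeal R • N (i + d)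

variable {N : ℤ → Submodule R M} {B : ℕ → Submodule R S} [SetLike.GradedMonoid B]
  {s : ℕ} {e : Fin s → ℤ} {g : Fin s → M}

lemma SetLike.pow_mem_graded' {x : S} {d : ℕ} (hx : x ∈ B d) (n : ℕ) : x ^ n ∈ B (n * d) :=
  SetLike.pow_mem_graded n hx

/-- The `n + 1` monomials of degree `n` in `x` and `y` are recorded by their values on the `s`
vectors `g j`. These values have at most `s * r` coordinates in all, so a relation modulo the
maximal ideal exists once `n + 1 > s * r`, and `detect` extends it to all of `N`. -/
lemma IsDetecting.exists_relation (h : IsDetecting N B e g) {r : ℕ}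
    (hr : ∀ᶠ i in Filter.atTop, (N i).spanFinrank ≤ r) {d : ℕ} (hd : 1 ≤ d) {x y : S}
    (hx : x ∈ B d) (hy : y ∈ B d) :
    ∃ (n : ℕ) (c : ℕ → R), (∃ i ≤ n, c i ∉ maximalIdeal R) ∧ ∀ i, ∀ m ∈ N i,
      (∑ j ∈ Finset.range (n + 1), c j • (x ^ (n - j) * y ^ j)) • m ∈
        maximalIdeal R • N (i + (n * d : ℕ)) := by
  obtain ⟨N₀, hN₀⟩ := Filter.eventually_atTop.1 hr
  -- Besides beating the coordinate count, `n` must push every `e j + n * d` into the range where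
  -- the bound `r` holds.
  obtain ⟨n, hn, hn'⟩ : ∃ n : ℕ, s * r < n + 1 ∧ ∀ j, N₀ ≤ e j + (n * d : ℕ) := by
    obtain ⟨K, hK⟩ : ∃ K : ℕ, ∀ j, N₀ - e j ≤ K := by
      refine ⟨∑ j, (N₀ - e j).natAbs, fun j => (Int.le_natAbs).trans ?_⟩
      exact_mod_cast Finset.single_le_sum (f := fun j => (N₀ - e j).natAbs)
        (fun _ _ => Nat.zero_le _) (Finset.mem_univ j)
    refine ⟨s * r + K, by omega, fun j => ?_⟩
    have h1 := hK j
    have h2 : s * r + K ≤ (s * r + K) * d := Nat.le_mul_of_pos_right _ hd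
    have h3 : K ≤ (s * r + K) * d := by omega
    have : (K : ℤ) ≤ ((s * r + K) * d : ℕ) := by exact_mod_cast h3
    linarith
  have hB : ∀ j ≤ n, x ^ (n - j) * y ^ j ∈ B (n * d) := by
    intro j hj
    have := SetLike.mul_mem_graded (SetLike.pow_mem_graded' hx (n - j))
      (SetLike.pow_mem_graded' hy j)
    rwa [← add_mul, Nat.sub_add_cancel hj] at this
  choose G hGc hGs using fun j =>
    (h.fg (e j + (n * d : ℕ))).exists_span_finset_card_eq_spanFinrank
  have hv : ∀ (i : Fin (n + 1)) (j : Fin s), ∃ a : G j → R,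
      ∑ k, a k • (k : M) = (x ^ (n - i : ℕ) * y ^ (i : ℕ)) • g j := by
    intro i j
    have := h.shiftsBy _ _ (hB i (by omega)) _ _ (h.mem j)
    rw [← hGs j, ← Subtype.range_coe (s := (G j : Set M)),
      Submodule.mem_span_range_iff_exists_fun] at this
    exact this
  choose a ha using hv
  obtain ⟨c, ⟨i, hi⟩, hc⟩ := exists_relation_mod_maximalIdeal
    (ι := Fin (n + 1)) (κ := Σ j, G j) (by
      rw [Fintype.card_sigma, Fintype.card_fin]
      refine lt_of_le_of_lt ?_ hn
      refine (Finset.sum_le_card_nsmul Finset.univ _ r fun j _ => ?_).trans (by simp)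
      rw [Fintype.card_coe, hGc]
      exact hN₀ _ (hn' j)) (fun i k => a i k.1 k.2)
  refine ⟨n, fun i => if hi : i < n + 1 then c ⟨i, hi⟩ else 0, ⟨i, by omega, by
    dsimp only
    rwa [dif_pos i.2]⟩, ?_⟩
  refine h.detect _ _ (Submodule.sum_mem _ fun j hj =>
    Submodule.smul_mem _ _ (hB j (by simp at hj; omega))) fun j => ?_
  rw [Finset.sum_range, Finset.sum_smul]
  have : ∀ i : Fin (n + 1), ((if hi : (i : ℕ) < n + 1 then c ⟨i, hi⟩ else 0) •
      (x ^ (n - i : ℕ) * y ^ (i : ℕ))) • g j = ∑ k, (c i * a i j k) • (k : M) := by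
    intro i
    rw [dif_pos i.2, smul_assoc, ← ha, Finset.smul_sum]
    simp only [smul_smul]
  rw [Finset.sum_congr rfl fun i _ => this i, Finset.sum_comm]
  refine Submodule.sum_mem _ fun k _ => ?_
  rw [← Finset.sum_smul]
  refine Submodule.smul_mem_smul (hc ⟨j, k⟩) ?_
  rw [← hGs j]
  exact Submodule.subset_span k.2

/-- Take the last unit coefficient `c l` of a relation. The terms after it vanish modulo the maximal
ideal, and `x ^ (n - l)` divides the others, leaving a form in which a power of `y` has a unit
coefficient. -/
lemma IsDetecting.exists_form (h : IsDetecting N B e g) {r : ℕ}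
    (hr : ∀ᶠ i in Filter.atTop, (N i).spanFinrank ≤ r) {d : ℕ} (hd : 1 ≤ d) {x y : S}
    (hx : x ∈ B d) (hy : y ∈ B d) :
    ∃ (J l : ℕ) (u : R) (t : S), IsUnit u ∧ t ∈ B (l * d) ∧ ∀ i, ∀ m ∈ N i,
      (x ^ J * (u • y ^ (l + 1) + x * t)) • m ∈
        maximalIdeal R • N (i + ((J + (l + 1)) * d : ℕ)) := by
  classical
  obtain ⟨n, c, ⟨i₁, hi₁, hi₁'⟩, hc⟩ := h.exists_relation hr hd hx hy
  obtain ⟨l, hl, hmax⟩ : ∃ l, (l ≤ n ∧ c l ∉ maximalIdeal R) ∧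
      ∀ j, l < j → j ≤ n → c j ∈ maximalIdeal R := by
    refine ⟨Nat.findGreatest (fun j => c j ∉ maximalIdeal R) n,
      ⟨Nat.findGreatest_le n, Nat.findGreatest_spec (P := fun j => c j ∉ maximalIdeal R) hi₁ hi₁'⟩,
      fun j hj hj' => not_not.1 (Nat.findGreatest_is_greatest hj hj')⟩
  have hB : ∀ k j, j ≤ k → x ^ (k - j) * y ^ j ∈ B (k * d) := by
    intro k j hj
    have := SetLike.mul_mem_graded (SetLike.pow_mem_graded' hx (k - j))
      (SetLike.pow_mem_graded' hy j)
    rwa [← add_mul, Nat.sub_add_cancel hj] at this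
  refine ⟨n - l, l, c l, ∑ j ∈ Finset.range l, c j • (x ^ (l - (j + 1)) * y ^ (j + 1)),
    notMem_maximalIdeal.1 hl.2, ?_, ?_⟩
  · exact Submodule.sum_mem _ fun j hj =>
      Submodule.smul_mem _ _ (hB l (j + 1) (by simp at hj; omega))
  intro i m hm
  -- The relation is multiplied by `y` so that the form has positive degree even when `l = 0`.
  have key : x ^ (n - l) * (c l • y ^ (l + 1) +
      x * ∑ j ∈ Finset.range l, c j • (x ^ (l - (j + 1)) * y ^ (j + 1))) =
      y * ((∑ j ∈ Finset.range (n + 1), c j • (x ^ (n - j) * y ^ j)) -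
        ∑ j ∈ Finset.Ico (l + 1) (n + 1), c j • (x ^ (n - j) * y ^ j)) := by
    rw [← Finset.sum_range_add_sum_Ico _ (show l + 1 ≤ n + 1 by omega), add_sub_cancel_right,
      Finset.sum_range_succ, add_comm (c l • _), mul_add, mul_add, ← mul_assoc, ← pow_succ,
      Finset.mul_sum, Finset.mul_sum]
    congr 1
    · refine Finset.sum_congr rfl fun j hj => ?_
      have : n - j = n - l + 1 + (l - (j + 1)) := by
        simp at hj
        omega
      rw [this, pow_add _ (n - l + 1), mul_smul_comm, mul_smul_comm]
      congr 1
      ring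
    · rw [mul_smul_comm, mul_smul_comm]
      congr 1
      ring
  rw [key, mul_smul, sub_smul]
  have e1 : i + ((n - l + (l + 1)) * d : ℕ) = i + (n * d : ℕ) + d := by
    have : n - l + (l + 1) = n + 1 := by omega
    rw [this]
    push_cast
    ring
  rw [e1]
  refine (h.shiftsBy d y hy).smul _ _ _ (sub_mem (hc i m hm) ?_)
  rw [Finset.sum_smul]
  refine Submodule.sum_mem _ fun j hj => ?_
  rw [Finset.mem_Ico] at hj
  rw [smul_assoc]
  exact Submodule.smul_mem_smul (hmax j (by omega) (by omega))
    (h.shiftsBy _ _ (hB n j (by omega)) _ _ hm)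

/-- An operator that is nilpotent modulo `V` can be dropped from a generating set modulo `V`. -/
lemma eventually_le_of_shiftImage_pow_le {N V : ℤ → Submodule R M} {x : S} {d : ℕ}
    (hV : ShiftsBy V x d) (h : ∀ᶠ i in Filter.atTop, N i ≤ shiftImage N x d i ⊔ V i) (a : ℕ)
    (ha : ∀ i, shiftImage N (x ^ a) (a * d) i ≤ V i) : ∀ᶠ i in Filter.atTop, N i ≤ V i := by
  filter_upwards [eventually_le_shiftImage_pow hV h a] with i hi
  exact hi.trans (sup_le (ha i) le_rfl)

/-- With `q` the form from `exists_form`, `x ^ J * q` vanishes modulo the maximal ideal. A sum of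
suitable powers of `x` and `q` then serves as `z`: both `x` and `q`, and with them `y`, are
nilpotent modulo `zN + W + 𝔪N`. -/
lemma IsDetecting.exists_of_two (h : IsDetecting N B e g) {r : ℕ}
    (hr : ∀ᶠ i in Filter.atTop, (N i).spanFinrank ≤ r) {d : ℕ} (hd : 1 ≤ d) {x y : S}
    (hx : x ∈ B d) (hy : y ∈ B d) (W : ℤ → Submodule R M) (hW : ∀ d, ∀ x ∈ B d, ShiftsBy W x d)
    (H : ∀ᶠ i in Filter.atTop, N i ≤ shiftImage N x d i ⊔ (shiftImage N y d i ⊔ W i)) :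
    ∃ D ≥ 1, ∃ z ∈ B D, ∀ᶠ i in Filter.atTop, N i ≤ shiftImage N z D i ⊔ W i := by
  obtain ⟨J, l, u, t, hu, ht, hf⟩ := h.exists_form hr hd hx hy
  set q := u • y ^ (l + 1) + x * t with hq
  have hqB : q ∈ B ((l + 1) * d) := by
    refine add_mem (Submodule.smul_mem _ _ (SetLike.pow_mem_graded' hy _)) ?_
    have := SetLike.mul_mem_graded hx ht
    rwa [add_comm, ← Nat.succ_mul] at this
  have hsub : ∀ {i : ℤ} {a b : ℕ}, b ≤ a → ∀ {m : M}, m ∈ N (i - (a * d : ℕ)) →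
      ∀ {p : S}, p ∈ B (b * d) → p • m ∈ N (i - ((a - b) * d : ℕ)) := by
    intro i a b hab m hm p hp
    convert h.shiftsBy _ _ hp _ _ hm using 2
    obtain ⟨c, rfl⟩ := Nat.exists_eq_add_of_le hab
    rw [Nat.add_sub_cancel_left]
    push_cast
    ring
  have hform : ∀ (a b : ℕ) (p : S), p ∈ B (b * d) → a = J + (l + 1) + b →
      ∀ i, ∀ m ∈ N (i - (a * d : ℕ)), (p * (x ^ J * q)) • m ∈ maximalIdeal R • N i := by
    rintro _ b p hp rfl i m hm
    rw [mul_smul]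
    have h1 := (h.shiftsBy _ _ hp).smul _ _ _ (hf _ m hm)
    convert h1 using 3
    push_cast
    ring
  -- The exponents give both summands the same degree. Since they exceed `J`, up to multiples of `x
  -- ^ J * q` the products `z * x ^ J` and `z * q` are a power of `x` and a power of `q`.
  let z := x ^ ((l + 1) * (J + 1)) + q ^ (J + 1)
  let D := (l + 1) * (J + 1) * d
  have hz : z ∈ B D := by
    refine add_mem (SetLike.pow_mem_graded' hx _) ?_
    have := SetLike.pow_mem_graded' hqB (J + 1)
    rwa [← mul_assoc, mul_comm (J + 1)] at this
  let V : ℤ → Submodule R M := fun i => (shiftImage N z D i ⊔ W i) ⊔ maximalIdeal R • N i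
  have hV : ∀ d, ∀ x ∈ B d, ShiftsBy V x d := fun d x hx =>
    (((h.shiftsBy d x hx).shiftImage (Or.inl (mul_comm _ _))).sup (hW d x hx)).sup
      ((h.shiftsBy d x hx).smul _)
  have hxV : ∀ i, shiftImage N (x ^ (J + (l + 1) * (J + 1))) ((J + (l + 1) * (J + 1)) * d) i ≤
      V i := by
    rintro i _ ⟨m, hm, rfl⟩
    change x ^ (J + (l + 1) * (J + 1)) • m ∈ _
    have : x ^ (J + (l + 1) * (J + 1)) • m = z • x ^ J • m - (q ^ J * (x ^ J * q)) • m := by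
      rw [smul_smul, ← sub_smul]
      congr 1
      ring
    rw [this]
    refine sub_mem (le_sup_left (a := shiftImage N z D i ⊔ W i)
      (le_sup_left (a := shiftImage N z D i) (mem_shiftImage.2 ⟨_, ?_, rfl⟩)))
      (le_sup_right (a := shiftImage N z D i ⊔ W i) (hform _ (J * (l + 1)) _ ?_ ?_ i m hm))
    · have := hsub (by omega) hm (SetLike.pow_mem_graded' hx J)
      rwa [Nat.add_sub_cancel_left] at this
    · rw [mul_assoc]
      exact SetLike.pow_mem_graded' hqB J
    · ring
  have hqV : ∀ i, shiftImage N (q ^ (J + 2)) ((J + 2) * ((l + 1) * d)) i ≤ V i := by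
    rintro i _ ⟨m, hm, rfl⟩
    rw [← mul_assoc] at hm
    change q ^ (J + 2) • m ∈ _
    have : q ^ (J + 2) • m = z • q • m - (x ^ (l * (J + 1) + 1) * (x ^ J * q)) • m := by
      rw [smul_smul, ← sub_smul]
      congr 1
      ring
    rw [this]
    refine sub_mem (le_sup_left (a := shiftImage N z D i ⊔ W i)
      (le_sup_left (a := shiftImage N z D i) (mem_shiftImage.2 ⟨_, ?_, rfl⟩)))
      (le_sup_right (a := shiftImage N z D i ⊔ W i)
        (hform _ (l * (J + 1) + 1) _ (SetLike.pow_mem_graded' hx _) ?_ i m hm))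
    · have := hsub (by nlinarith) hm hqB
      have e1 : (J + 2) * (l + 1) - (l + 1) = (l + 1) * (J + 1) := by
        rw [← Nat.sub_one_mul, mul_comm]
        rfl
      rwa [e1] at this
    · ring
  have hWV : ∀ i, W i ≤ V i := fun i => le_sup_of_le_left le_sup_right
  -- Modulo `V`, drop the nilpotent `x`, so that `y` alone generates, hence also `y ^ (l + 1) = u⁻¹
  -- (q - x t)`. Thus `q` and `x` generate modulo `V`; drop `q`, then `x`.
  have H1 : ∀ᶠ i in Filter.atTop, N i ≤ shiftImage N y d i ⊔ V i := by
    refine eventually_le_of_shiftImage_pow_le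
      (((h.shiftsBy d x hx).shiftImage (Or.inl (mul_comm _ _))).sup (hV d x hx)) ?_ _
      fun i => (hxV i).trans le_sup_right
    filter_upwards [H] with i hi
    exact hi.trans (sup_le_sup_left (sup_le_sup_left (hWV i) _) _)
  have H2 : ∀ᶠ i in Filter.atTop, N i ≤ shiftImage N x d i ⊔ V i := by
    refine eventually_le_of_shiftImage_pow_le
      (((h.shiftsBy _ q hqB).shiftImage (Or.inl (mul_comm _ _))).sup (hV _ q hqB)) ?_ _
      fun i => (hqV i).trans le_sup_right
    filter_upwards [eventually_le_shiftImage_pow (hV d y hy) H1 (l + 1)] with i hi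
    refine hi.trans (sup_le ?_ (le_sup_of_le_right le_sup_right))
    rintro _ ⟨m, hm, rfl⟩
    obtain ⟨v, hv⟩ := hu.exists_left_inv
    change y ^ (l + 1) • m ∈ _
    have : y ^ (l + 1) • m = q • v • m + x • t • -(v • m) := by
      have h2 : q • v • m = (v * u) • y ^ (l + 1) • m + x • t • v • m := by
        rw [hq, add_smul, mul_smul, smul_assoc, smul_comm (y ^ (l + 1)) v, smul_smul, mul_comm u]
      rw [h2, hv]
      simp
    rw [this]
    refine Submodule.add_mem_sup (mem_shiftImage.2 ⟨_, Submodule.smul_mem _ _ hm, rfl⟩)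
      (le_sup_left (a := shiftImage N x d i) (mem_shiftImage.2 ⟨_, ?_, rfl⟩))
    have := hsub (by omega) (neg_mem (Submodule.smul_mem _ v hm)) ht
    rwa [Nat.add_sub_cancel_left, one_mul] at this
  have H3 := eventually_le_of_shiftImage_pow_le (hV d x hx) H2 _ hxV
  refine ⟨D, Nat.mul_pos (Nat.mul_pos l.succ_pos J.succ_pos) hd, z, hz, ?_⟩
  filter_upwards [H3] with i hi
  -- Nakayama removes the summand `maximalIdeal R • N i` of `V i`.
  exact Submodule.le_of_le_smul_of_le_jacobson_bot (h.fg i) (maximalIdeal_le_jacobson _) hi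

/-- If the numbers of generators are bounded, then a family which is eventually generated by
finitely many operators is eventually generated by one operator. -/
lemma IsDetecting.exists_of_list (h : IsDetecting N B e g) {r : ℕ}
    (hr : ∀ᶠ i in Filter.atTop, (N i).spanFinrank ≤ r) (L : List (ℕ × S))
    (hL : ∀ p ∈ L, 1 ≤ p.1 ∧ p.2 ∈ B p.1) (W : ℤ → Submodule R M)
    (hW : ∀ d, ∀ x ∈ B d, ShiftsBy W x d)
    (H : ∀ᶠ i in Filter.atTop, N i ≤ sumImage N L i ⊔ W i) :
    ∃ D ≥ 1, ∃ z ∈ B D, ∀ᶠ i in Filter.atTop, N i ≤ shiftImage N z D i ⊔ W i := by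
  induction L generalizing W with
  | nil =>
    refine ⟨1, le_rfl, 0, zero_mem _, ?_⟩
    filter_upwards [H] with i hi
    exact hi.trans (sup_le bot_le le_sup_right)
  | cons p L ih =>
    obtain ⟨hd, hx⟩ := hL p (by simp)
    have hxN := fun {d' : ℕ} {y : S} (hy : y ∈ B d') (k : ℕ) (x : S) =>
      (h.shiftsBy d' y hy).shiftImage (e := k) (y := x) (Or.inl (mul_comm _ _))
    obtain ⟨D, hD, z, hz, H'⟩ := ih (fun q hq => hL q (List.mem_cons_of_mem _ hq))
      (fun i => shiftImage N p.2 p.1 i ⊔ W i) (fun d y hy => (hxN hy _ _).sup (hW d y hy)) (by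
        filter_upwards [H] with i hi
        refine hi.trans (le_of_eq ?_)
        change (shiftImage N p.2 p.1 i ⊔ _) ⊔ _ = _
        rw [sup_assoc, sup_left_comm])
    -- Powers of `z` and of `p.2` are taken so that both operators have degree `p.1 * D`, as
    -- `exists_of_two` requires.
    have H1 := eventually_le_shiftImage_pow ((hxN hz _ _).sup (hW D z hz)) H' p.1
    have H2 : ∀ᶠ i in Filter.atTop, N i ≤
        shiftImage N p.2 p.1 i ⊔ (shiftImage N (z ^ p.1) (p.1 * D) i ⊔ W i) := by
      filter_upwards [H1] with i hi
      rwa [sup_left_comm]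
    have H3 := eventually_le_shiftImage_pow ((hxN hx _ _).sup (hW p.1 p.2 hx)) H2 D
    have hz' := SetLike.pow_mem_graded' hz p.1
    rw [mul_comm] at hz'
    refine h.exists_of_two hr (Nat.mul_pos hD hd) (SetLike.pow_mem_graded' hx D) hz' W hW ?_
    simpa only [mul_comm p.1 D] using H3

end BoundedGrowth

/-! ### Graded-commutative rings -/

section GradedCommutative

variable {H : Type*} [Ring H] {𝒜 : ℕ → AddSubgroup H} [GradedRing 𝒜]

lemma IsGradedCommutative.mul_eq_or (hcomm : IsGradedCommutative 𝒜) {p q : ℕ} {x y : H}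
    (hx : x ∈ 𝒜 p) (hy : y ∈ 𝒜 q) : x * y = y * x ∨ x * y = -(y * x) := by
  rw [hcomm p q x y hx hy]
  rcases neg_one_pow_eq_or H (p * q) with h | h <;> simp [h]

lemma IsGradedCommutative.mem_center_of_even (hcomm : IsGradedCommutative 𝒜) {p : ℕ}
    (hp : Even p) {x : H} (hx : x ∈ 𝒜 p) : x ∈ Subring.center H := by
  rw [Subring.mem_center_iff]
  intro y
  induction y using DirectSum.Decomposition.inductionOn 𝒜 with
  | zero => simp
  | homogeneous y =>
    rw [hcomm p _ x y hx y.2, (hp.mul_right _).neg_one_pow, one_mul]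
  | add y y' h h' => rw [add_mul, mul_add, h, h']

/-- The degree zero part of a graded-commutative ring is commutative. -/
@[reducible]
def degreeZeroCommRing (hcomm : IsGradedCommutative 𝒜) : CommRing (degreeZero 𝒜) :=
  { (inferInstance : Ring (degreeZero 𝒜)) with
    mul_comm := fun x y => Subtype.ext (by
      simpa using hcomm 0 0 x y x.2 y.2) }

/-- If `x`, `y` are outside `I`, let `i`, `j` be the top degrees of components outside `I`. In
degree `i + j` of `x * y` every product except that of these two components lies in `I`. Ideals are
left ideals here, so absorption on the right is a hypothesis. -/
lemma Ideal.IsHomogeneous.isPrime_of_mul_mem_right {I : Ideal H} (hI : I.IsHomogeneous 𝒜)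
    (hne : I ≠ ⊤) (hright : ∀ x ∈ I, ∀ y, x * y ∈ I)
    (hmul : ∀ i j, ∀ x ∈ 𝒜 i, ∀ y ∈ 𝒜 j, x * y ∈ I → x ∈ I ∨ y ∈ I) : I.IsPrime := by
  classical
  have key : ∀ x ∉ I, ∃ i : ℕ, ((DirectSum.decompose 𝒜 x i : H) ∉ I) ∧
      ∀ k, i < k → (DirectSum.decompose 𝒜 x k : H) ∈ I := by
    intro x hx
    let s := (DirectSum.decompose 𝒜 x).support.filter fun i =>
      (DirectSum.decompose 𝒜 x i : H) ∉ I
    have hs : s.Nonempty := by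
      rw [Finset.nonempty_iff_ne_empty]
      intro h
      refine hx ?_
      rw [← DirectSum.sum_support_decompose 𝒜 x]
      refine Ideal.sum_mem _ fun i hi => by_contra fun hi' => ?_
      have : i ∈ s := Finset.mem_filter.2 ⟨hi, hi'⟩
      simp [h] at this
    refine ⟨s.max' hs, (Finset.mem_filter.1 (s.max'_mem hs)).2, fun k hk => by_contra fun hk' => ?_⟩
    have : k ∈ s := by
      refine Finset.mem_filter.2 ⟨?_, hk'⟩
      rw [DFinsupp.mem_support_iff]
      intro h0
      rw [h0] at hk'
      exact hk' (zero_mem I)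
    exact absurd (s.le_max' k this) (not_le.2 hk)
  refine ⟨hne, fun {x y} hxy => ?_⟩
  by_contra! h
  obtain ⟨i, hi, hi'⟩ := key x h.1
  obtain ⟨j, hj, hj'⟩ := key y h.2
  have h1 := hI (i + j) hxy
  rw [DirectSum.decompose_mul, DirectSum.coe_mul_apply] at h1
  have h2 : ∀ ij ∈ ((DirectSum.decompose 𝒜 x).support ×ˢ (DirectSum.decompose 𝒜 y).support).filter
      (fun ij : ℕ × ℕ => ij.1 + ij.2 = i + j), ij ≠ (i, j) →
      ((DirectSum.decompose 𝒜 x ij.1 : H) * DirectSum.decompose 𝒜 y ij.2) ∈ I := by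
    rintro ⟨a, b⟩ hab hne
    have hab' : a + b = i + j := (Finset.mem_filter.1 hab).2
    rcases lt_trichotomy a i with ha | rfl | ha
    · exact I.mul_mem_left _ (hj' b (by omega))
    · obtain rfl : b = j := by omega
      exact absurd rfl hne
    · exact hright _ (hi' a ha) _
  have h3 : (DirectSum.decompose 𝒜 x i : H) * DirectSum.decompose 𝒜 y j ∈ I := by
    have hmem : (i, j) ∈ ((DirectSum.decompose 𝒜 x).support ×ˢ
        (DirectSum.decompose 𝒜 y).support).filter (fun ij : ℕ × ℕ => ij.1 + ij.2 = i + j) := by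
      refine Finset.mem_filter.2 ⟨Finset.mem_product.2 ⟨?_, ?_⟩, rfl⟩
      · rw [DFinsupp.mem_support_iff]
        intro h0
        rw [h0] at hi
        exact hi (zero_mem I)
      · rw [DFinsupp.mem_support_iff]
        intro h0
        rw [h0] at hj
        exact hj (zero_mem I)
    rw [← Finset.add_sum_erase _ _ hmem] at h1
    refine (I.add_mem_iff_left (Ideal.sum_mem _ fun ij hij => ?_)).1 h1
    exact h2 ij (Finset.mem_of_mem_erase hij) (Finset.ne_of_mem_erase hij)
  exact (hmul i j _ (SetLike.coe_mem _) _ (SetLike.coe_mem _) h3).elim hi hj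

end GradedCommutative

/-! ### Finitely generated graded modules -/

section GradedModule

variable {R H M : Type*} [CommRing R] [Ring H] [Algebra R H] {𝒜 : ℕ → AddSubgroup H}
  [GradedRing 𝒜] [AddCommGroup M] [Module R M] [Module H M] [IsScalarTower R H M]
  {N : ℤ → Submodule R M} [DirectSum.Decomposition N]

lemma decompose_smul_of_mem_left (hN : ∀ d, ∀ x ∈ 𝒜 d, ShiftsBy N x d) {d : ℕ} {x : H}
    (hx : x ∈ 𝒜 d) (m : M) (i : ℤ) :
    (DirectSum.decompose N (x • m) i : M) = x • (DirectSum.decompose N m (i - d) : M) := by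
  induction m using DirectSum.Decomposition.inductionOn N with
  | zero => simp
  | @homogeneous k m =>
    by_cases h : k = i - d
    · subst h
      rw [DirectSum.decompose_of_mem_same N m.2]
      refine DirectSum.decompose_of_mem_same N ?_
      simpa using hN d x hx _ _ m.2
    · rw [DirectSum.decompose_of_mem_ne N m.2 h, smul_zero]
      exact DirectSum.decompose_of_mem_ne N (hN d x hx _ _ m.2) (by omega)
  | add m m' h h' =>
    simp [smul_add, DirectSum.decompose_add, h, h']

lemma decompose_smul_of_mem_right (hN : ∀ d, ∀ x ∈ 𝒜 d, ShiftsBy N x d) (x : H) {n : ℤ} {m : M}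
    (hm : m ∈ N n) (i : ℕ) :
    (DirectSum.decompose N (x • m) (n + i) : M) = (DirectSum.decompose 𝒜 x i : H) • m := by
  induction x using DirectSum.Decomposition.inductionOn 𝒜 with
  | zero => simp
  | @homogeneous k x =>
    by_cases h : k = i
    · subst h
      rw [DirectSum.decompose_of_mem_same 𝒜 x.2]
      exact DirectSum.decompose_of_mem_same N (hN _ x x.2 _ _ hm)
    · rw [DirectSum.decompose_of_mem_ne 𝒜 x.2 h, zero_smul]
      exact DirectSum.decompose_of_mem_ne N (hN _ x x.2 _ _ hm) (by omega)
  | add m m' h h' =>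
    simp [add_smul, DirectSum.decompose_add, h, h']

/-- Comparing degrees in an `H`-linear combination of homogeneous elements leaves only homogeneous
coefficients of complementary degree. An additive closure can later be compared with `R`-submodules
and `H`-submodules alike. -/
lemma decompose_mem_closure (hN : ∀ d, ∀ x ∈ 𝒜 d, ShiftsBy N x d) {G : Set (ℤ × M)}
    (hG : ∀ p ∈ G, p.2 ∈ N p.1) {m : M} (hm : m ∈ Submodule.span H (Prod.snd '' G)) (i : ℤ) :
    (DirectSum.decompose N m i : M) ∈ AddSubgroup.closure
      {y : M | ∃ k : ℕ, ∃ r ∈ 𝒜 k, ∃ p ∈ G, p.1 + k = i ∧ y = r • p.2} := by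
  induction hm using Submodule.span_induction generalizing i with
  | zero => simp
  | mem m hm =>
    obtain ⟨p, hp, rfl⟩ := hm
    by_cases h : p.1 = i
    · subst h
      rw [DirectSum.decompose_of_mem_same N (hG p hp)]
      exact AddSubgroup.subset_closure
        ⟨0, 1, SetLike.one_mem_graded 𝒜, p, hp, by simp, (one_smul _ _).symm⟩
    · rw [DirectSum.decompose_of_mem_ne N (hG p hp) h]
      exact zero_mem _
  | add m m' _ _ h h' =>
    rw [DirectSum.decompose_add]
    exact add_mem (h i) (h' i)
  | smul x m _ h =>
    induction x using DirectSum.Decomposition.inductionOn 𝒜 with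
    | zero => simp
    | @homogeneous k x =>
      rw [decompose_smul_of_mem_left hN x.2]
      have := h (i - k)
      generalize (DirectSum.decompose N m (i - k) : M) = y at this
      induction this using AddSubgroup.closure_induction with
      | zero => simp
      | mem y hy =>
        obtain ⟨l, r, hr, p, hp, hl, rfl⟩ := hy
        refine AddSubgroup.subset_closure ⟨k + l, x * r, SetLike.mul_mem_graded x.2 hr, p, hp, ?_,
          smul_smul _ _ _⟩
        push_cast
        omega
      | add y y' _ _ hy hy' =>
        rw [smul_add]
        exact add_mem hy hy'
      | neg y _ hy =>
        rw [smul_neg]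
        exact neg_mem hy
    | add x x' hx hx' =>
      rw [add_smul, DirectSum.decompose_add]
      exact add_mem hx hx'

lemma mem_closure_of_mem_span (hN : ∀ d, ∀ x ∈ 𝒜 d, ShiftsBy N x d) {G : Set (ℤ × M)}
    (hG : ∀ p ∈ G, p.2 ∈ N p.1) {m : M} (hm : m ∈ Submodule.span H (Prod.snd '' G)) {i : ℤ}
    (hi : m ∈ N i) : m ∈ AddSubgroup.closure
      {y : M | ∃ k : ℕ, ∃ r ∈ 𝒜 k, ∃ p ∈ G, p.1 + k = i ∧ y = r • p.2} := by
  have := decompose_mem_closure hN hG hm i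
  rwa [DirectSum.decompose_of_mem_same N hi] at this

lemma exists_finset_span_eq [IsNoetherian H M] (P : Set (ℤ × M)) :
    ∃ G : Finset (ℤ × M), (G : Set (ℤ × M)) ⊆ P ∧
      Submodule.span H (Prod.snd '' (G : Set (ℤ × M))) = Submodule.span H (Prod.snd '' P) := by
  classical
  obtain ⟨s, hs, hs'⟩ := (Submodule.fg_span_iff_fg_span_finset_subset (R := H) (Prod.snd '' P)).1
    (IsNoetherian.noetherian _)
  obtain ⟨G, hG, rfl⟩ := Finset.subset_set_image_iff.1 hs
  exact ⟨G, hG, by rw [hs', Finset.coe_image]⟩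

variable (N) in
lemma exists_homogeneous_generators [IsNoetherian H M] :
    ∃ G : Finset (ℤ × M), (∀ p ∈ G, p.2 ∈ N p.1) ∧
      Submodule.span H (Prod.snd '' (G : Set (ℤ × M))) = ⊤ := by
  obtain ⟨G, hG, hG'⟩ := exists_finset_span_eq (H := H) {p : ℤ × M | p.2 ∈ N p.1}
  refine ⟨G, fun p hp => hG hp, hG'.trans (eq_top_iff.2 fun m _ => ?_)⟩
  induction m using DirectSum.Decomposition.inductionOn N with
  | zero => exact zero_mem _
  | @homogeneous k m => exact Submodule.subset_span ⟨(k, m), m.2, rfl⟩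
  | add m m' h h' => exact add_mem (h trivial) (h' trivial)

/-- The `H`-submodule spanned by `N n` has finitely many generators inside `N n`, and for degree
reasons elements of `N n` need only coefficients of degree zero, which come from `R`. -/
lemma fg_of_isNoetherian [IsNoetherian H M] (hN : ∀ d, ∀ x ∈ 𝒜 d, ShiftsBy N x d)
    (hR : ∀ x ∈ 𝒜 0, ∃ r : R, algebraMap R H r = x) (n : ℤ) : (N n).FG := by
  classical
  obtain ⟨G, hG, hG'⟩ := exists_finset_span_eq (H := H) {p : ℤ × M | p.1 = n ∧ p.2 ∈ N n}
  refine ⟨G.image Prod.snd, le_antisymm (Submodule.span_le.2 ?_) fun m hm => ?_⟩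
  · rw [Finset.coe_image]
    rintro _ ⟨p, hp, rfl⟩
    exact (hG hp).2
  · have h1 : m ∈ Submodule.span H (Prod.snd '' (G : Set (ℤ × M))) := by
      rw [hG']
      exact Submodule.subset_span ⟨(n, m), ⟨rfl, hm⟩, rfl⟩
    have h2 := mem_closure_of_mem_span hN (fun p hp => by
      rw [(hG hp).1]
      exact (hG hp).2) h1 hm
    refine (AddSubgroup.closure_le (K := (Submodule.span R _).toAddSubgroup)).2 ?_ h2
    rintro _ ⟨k, r, hr, p, hp, hk, rfl⟩
    obtain rfl : k = 0 := by
      have := (hG hp).1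
      omega
    obtain ⟨r, rfl⟩ := hR r hr
    rw [algebraMap_smul]
    refine Submodule.smul_mem _ _ (Submodule.subset_span ?_)
    rw [Finset.coe_image]
    exact ⟨p, hp, rfl⟩

lemma exists_bounds_degree (G : Finset (ℤ × M)) : ∃ K : ℤ, ∀ p ∈ G, p.1 ≤ K ∧ -K ≤ p.1 := by
  refine ⟨∑ p ∈ G, |p.1|, fun p hp => ?_⟩
  have := Finset.single_le_sum (f := fun p : ℤ × M => |p.1|) (fun _ _ => abs_nonneg _) hp
  exact ⟨(le_abs_self _).trans this, by linarith [neg_abs_le p.1]⟩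

variable [IsNoetherian H M]

lemma eventually_atBot_eq_bot (hN : ∀ d, ∀ x ∈ 𝒜 d, ShiftsBy N x d) :
    ∀ᶠ i in Filter.atBot, N i = ⊥ := by
  obtain ⟨G, hG, hG'⟩ := exists_homogeneous_generators (H := H) N
  obtain ⟨K, hK⟩ := exists_bounds_degree G
  filter_upwards [Filter.eventually_lt_atBot (-K)] with i hi
  rw [eq_bot_iff]
  intro m hm
  have := mem_closure_of_mem_span hN hG (by rw [hG']; trivial) hm
  refine (AddSubgroup.closure_le (K := (⊥ : Submodule R M).toAddSubgroup)).2 ?_ this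
  rintro _ ⟨k, r, hr, p, hp, hk, rfl⟩
  have := hK p hp
  omega

lemma eventually_eq_bot_of_smul_eq_zero (hN : ∀ d, ∀ x ∈ 𝒜 d, ShiftsBy N x d)
    (h : ∀ᶠ k in Filter.atTop, ∀ x ∈ 𝒜 k, ∀ m : M, x • m = 0) :
    ∀ᶠ i in Filter.atTop, N i = ⊥ := by
  obtain ⟨G, hG, hG'⟩ := exists_homogeneous_generators (H := H) N
  obtain ⟨K, hK⟩ := exists_bounds_degree G
  obtain ⟨K', hK'⟩ := Filter.eventually_atTop.1 h
  filter_upwards [Filter.eventually_ge_atTop (K + K')] with i hi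
  rw [eq_bot_iff]
  intro m hm
  have := mem_closure_of_mem_span hN hG (by rw [hG']; trivial) hm
  refine (AddSubgroup.closure_le (K := (⊥ : Submodule R M).toAddSubgroup)).2 ?_ this
  rintro _ ⟨k, r, hr, p, hp, hk, rfl⟩
  have := hK p hp
  exact hK' k (by omega) r hr _

/-- In high degrees, a finitely generated graded module is generated by the images of finitely many
central homogeneous elements of positive degree. -/
lemma exists_central_list (hcomm : IsGradedCommutative 𝒜)
    (hN : ∀ d, ∀ x ∈ 𝒜 d, ShiftsBy N x d) :
    ∃ L : List (ℕ × H), (∀ p ∈ L, 1 ≤ p.1 ∧ p.2 ∈ 𝒜 p.1 ∧ p.2 ∈ Subring.center H) ∧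
      ∀ᶠ i in Filter.atTop, N i ≤ sumImage N L i := by
  obtain ⟨G₀, hG₀, hG₀'⟩ := exists_homogeneous_generators (H := H) N
  obtain ⟨K, hK⟩ := exists_bounds_degree G₀
  -- `G` generates the submodule spanned by all `x • m` with `x` of positive degree. It contains `N
  -- i` for `i > K`, since the generators `G₀` have degree at most `K`.
  obtain ⟨G, hG, hG'⟩ := exists_finset_span_eq (H := H) {p : ℤ × M | ∃ (d : ℕ) (x : H) (m : M),
    1 ≤ d ∧ x ∈ 𝒜 d ∧ m ∈ N (p.1 - d) ∧ p.2 = x • m}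
  choose! d x m hd hx hm hp using fun (p : ℤ × M) (hp : p ∈ G) => hG hp
  let L : List (ℕ × H) := G.toList.map fun p => (d p, x p)
  have hL : ∀ q ∈ L, 1 ≤ q.1 ∧ q.2 ∈ 𝒜 q.1 := by
    intro q hq
    obtain ⟨p, hp, rfl⟩ := List.mem_map.1 hq
    rw [Finset.mem_toList] at hp
    exact ⟨hd p hp, hx p hp⟩
  have h1 : ∀ᶠ i in Filter.atTop, N i ≤ sumImage N L i ⊔ ⊥ := by
    filter_upwards [Filter.eventually_gt_atTop K] with i hi
    rw [sup_bot_eq]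
    intro y hy
    have h2 : y ∈ Submodule.span H (Prod.snd '' (G : Set (ℤ × M))) := by
      rw [hG']
      have := mem_closure_of_mem_span hN hG₀ (by rw [hG₀']; trivial) hy
      refine (AddSubgroup.closure_le (K := (Submodule.span H _).toAddSubgroup)).2 ?_ this
      rintro _ ⟨k, r, hr, p, hp, hk, rfl⟩
      have := hK p hp
      refine Submodule.subset_span ⟨(i, r • p.2), ⟨k, r, p.2, by omega, hr, ?_, rfl⟩, rfl⟩
      change p.2 ∈ N (i - k)
      rw [← hk, add_sub_cancel_right]
      exact hG₀ p hp
    have h3 := mem_closure_of_mem_span hN (fun p hp' => by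
      have := hN _ _ (hx p hp') _ _ (hm p hp')
      rwa [sub_add_cancel, ← hp p hp'] at this) h2 hy
    refine (AddSubgroup.closure_le (K := (sumImage N L i).toAddSubgroup)).2 ?_ h3
    rintro _ ⟨k, r, hr, p, hp', hk, rfl⟩
    refine shiftImage_le_sumImage N (L := L) (p := (d p, x p))
      (List.mem_map.2 ⟨p, Finset.mem_toList.2 hp', rfl⟩) i ?_
    have h4 : r • m p ∈ N (i - d p) := by
      have := hN _ r hr _ _ (hm p hp')
      rwa [show p.1 - d p + k = i - d p by omega] at this
    rw [hp p hp', smul_smul]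
    rcases hcomm.mul_eq_or hr (hx p hp') with h | h
    · exact mem_shiftImage.2 ⟨r • m p, h4, by rw [h, smul_smul]⟩
    · exact mem_shiftImage.2 ⟨-(r • m p), neg_mem h4, by rw [h, smul_neg, smul_smul, neg_smul]⟩
  -- Squares have even degree and are therefore central.
  have h2 := eventually_le_sumImage_pow 2 L (fun p hp => hN _ _ (hL p hp).2)
    (fun p hp q hq => hcomm.mul_eq_or (hL p hp).2 (hL q hq).2) (fun _ => ⊥)
    (fun p _ i m hm => by
      rw [(Submodule.mem_bot R).1 hm, smul_zero]
      exact zero_mem _) h1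
  refine ⟨_, ?_, by simpa only [sup_bot_eq] using h2⟩
  intro p hp
  obtain ⟨q, hq, rfl⟩ := List.mem_map.1 hp
  have h3 : q.2 ^ 2 ∈ 𝒜 (2 * q.1) := by
    have := SetLike.pow_mem_graded 2 (hL q hq).2
    rwa [smul_eq_mul] at this
  exact ⟨by have := (hL q hq).1; dsimp only; omega, h3, hcomm.mem_center_of_even (even_two_mul _) h3⟩

end GradedModule

/-! ### Central operators on graded modules of bounded growth -/

section Central

variable {R H M : Type*} [CommRing R] [Ring H] [Algebra R H] {𝒜 : ℕ → AddSubgroup H}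
  [GradedRing 𝒜] [AddCommGroup M] [Module R M] [Module H M] [IsScalarTower R H M]
  {N : ℤ → Submodule R M} [DirectSum.Decomposition N]

/-- The central elements of degree `d`. -/
def centralDegree (𝒜 : ℕ → AddSubgroup H) [GradedRing 𝒜]
    (h0 : ∀ r : R, algebraMap R H r ∈ 𝒜 0) (d : ℕ) : Submodule R (Subalgebra.center R H) where
  carrier := {x | (x : H) ∈ 𝒜 d}
  add_mem' {x y} hx hy := (add_mem hx hy : (x : H) + y ∈ 𝒜 d)
  zero_mem' := zero_mem (𝒜 d)
  smul_mem' r x hx := by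
    have := SetLike.mul_mem_graded (h0 r) hx
    rw [zero_add, ← Algebra.smul_def] at this
    exact this

lemma mem_centralDegree {h0 : ∀ r : R, algebraMap R H r ∈ 𝒜 0} {d : ℕ}
    {x : Subalgebra.center R H} : x ∈ centralDegree 𝒜 h0 d ↔ (x : H) ∈ 𝒜 d := Iff.rfl

instance (h0 : ∀ r : R, algebraMap R H r ∈ 𝒜 0) : SetLike.GradedMonoid (centralDegree 𝒜 h0) where
  one_mem := mem_centralDegree.2 (SetLike.one_mem_graded 𝒜)
  mul_mem _ _ _ _ hx hy := mem_centralDegree.2 <| SetLike.mul_mem_graded (A := 𝒜) hx hy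

/-- Regards central operators as elements of the commutative ring `Subalgebra.center R H`, over
which the bounded growth argument takes place. -/
lemma exists_sumImage_center (h0 : ∀ r : R, algebraMap R H r ∈ 𝒜 0) (L : List (ℕ × H))
    (hL : ∀ p ∈ L, 1 ≤ p.1 ∧ p.2 ∈ 𝒜 p.1 ∧ p.2 ∈ Subring.center H) :
    ∃ L' : List (ℕ × Subalgebra.center R H),
      (∀ p ∈ L', 1 ≤ p.1 ∧ p.2 ∈ centralDegree 𝒜 h0 p.1) ∧
      ∀ i, sumImage N L' i = sumImage N L i := by
  induction L with
  | nil => exact ⟨[], by simp, fun i => rfl⟩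
  | cons p L ih =>
    obtain ⟨L', h1, h2⟩ := ih fun q hq => hL q (List.mem_cons_of_mem _ hq)
    obtain ⟨hp1, hp2, hp3⟩ := hL p (by simp)
    refine ⟨(p.1, ⟨p.2, hp3⟩) :: L', ?_, fun i => ?_⟩
    · intro q hq
      rcases List.mem_cons.1 hq with rfl | hq
      · exact ⟨hp1, mem_centralDegree.2 hp2⟩
      · exact h1 q hq
    · change shiftImage N _ p.1 i ⊔ sumImage N L' i = shiftImage N p.2 p.1 i ⊔ sumImage N L i
      rw [h2]
      rfl

variable [IsNoetherian H M]

lemma exists_central_of_bounded [IsLocalRing R] (hcomm : IsGradedCommutative 𝒜)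
    (h0 : ∀ r : R, algebraMap R H r ∈ 𝒜 0) (hR : ∀ x ∈ 𝒜 0, ∃ r : R, algebraMap R H r = x)
    (hN : ∀ d, ∀ x ∈ 𝒜 d, ShiftsBy N x d) {r : ℕ}
    (hr : ∀ᶠ i in Filter.atTop, (N i).spanFinrank ≤ r) :
    ∃ D ≥ 1, ∃ z ∈ 𝒜 D, z ∈ Subring.center H ∧
      ∀ᶠ i in Filter.atTop, N i ≤ shiftImage N z D i := by
  obtain ⟨G, hG, hG'⟩ := exists_homogeneous_generators (H := H) N
  let g := fun j => (G.equivFin.symm j).1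
  -- A central `p` commutes with `H`, so its values on homogeneous `H`-generators of `M` decide
  -- whether it maps `N` into `𝔪N`.
  have hdet : IsDetecting N (centralDegree 𝒜 h0) (fun j => (g j).1) (fun j => (g j).2) := by
    refine ⟨fun d x hx => hN d x (mem_centralDegree.1 hx), fg_of_isNoetherian hN hR,
      fun j => hG _ (G.equivFin.symm j).2, fun d p hp h i m hm => ?_⟩
    have h1 := mem_closure_of_mem_span hN hG (by rw [hG']; trivial) hm
    clear hm
    induction h1 using AddSubgroup.closure_induction with
    | zero => simp
    | mem y hy =>
      obtain ⟨k, x, hx, q, hq, rfl, rfl⟩ := hy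
      have h2 := h (G.equivFin ⟨q, hq⟩)
      simp only [g, Equiv.symm_apply_apply] at h2
      have h3 := (hN k x hx).smul (IsLocalRing.maximalIdeal R) _ _ h2
      have h4 : p • x • q.2 = x • p • q.2 := by
        change (p : H) • x • q.2 = x • (p : H) • q.2
        rw [smul_smul, smul_smul, (Subring.mem_center_iff.1 p.2 x)]
      rw [h4, add_right_comm]
      exact h3
    | add y y' _ _ h h' =>
      rw [smul_add]
      exact add_mem h h'
    | neg y _ h =>
      rw [smul_neg]
      exact neg_mem h
  obtain ⟨L, hL, h⟩ := exists_central_list hcomm hN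
  obtain ⟨L', hL', hLL⟩ := exists_sumImage_center (N := N) h0 L hL
  obtain ⟨D, hD, z, hz, H⟩ := hdet.exists_of_list hr L' hL' (fun _ => ⊥)
    (fun _ _ _ i m hm => by
      rw [(Submodule.mem_bot R).1 hm, smul_zero]
      exact zero_mem _) (by
      filter_upwards [h] with i hi
      exact (hi.trans (hLL i).ge).trans le_sup_left)
  exact ⟨D, hD, z, mem_centralDegree.1 hz, z.2, by simpa only [sup_bot_eq] using! H⟩

/-- Fitting's argument: on a Noetherian module the kernel and the image of `z ^ n` meet trivially
for large `n`, and in high degrees all of `N i` lies in that image. -/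
lemma eventually_injective_of_le_shiftImage {z : H} (hz : z ∈ Subring.center H) {D : ℕ}
    (h : ∀ᶠ i in Filter.atTop, N i ≤ shiftImage N z D i) :
    ∀ᶠ i in Filter.atTop, ∀ m ∈ N i, z • m = 0 → m = 0 := by
  let f : M →ₗ[H] M :=
    { toFun := fun m => z • m
      map_add' := smul_add z
      map_smul' := fun x m => by
        rw [RingHom.id_apply, smul_smul, smul_smul, Subring.mem_center_iff.1 hz x] }
  have hf : ∀ (n : ℕ) (m : M), (f ^ n) m = z ^ n • m := by
    intro n
    induction n with
    | zero => simp
    | succ n ih =>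
      intro m
      rw [pow_succ', pow_succ', Module.End.mul_apply, ih, mul_smul]
      rfl
  obtain ⟨n, hn, hn1⟩ := ((Module.End.eventually_disjoint_ker_pow_range_pow f).and
    (Filter.eventually_ge_atTop 1)).exists
  have h1 := eventually_le_shiftImage_pow (W := fun _ => ⊥) (x := z) (d := D) (N := N)
    (fun i m hm => by
      rw [(Submodule.mem_bot R).1 hm, smul_zero]
      exact zero_mem _) (by simpa only [sup_bot_eq] using h) n
  filter_upwards [h1] with i hi m hm hzm
  rw [sup_bot_eq] at hi
  obtain ⟨u, hu, rfl⟩ := hi hm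
  rw [Submodule.disjoint_def] at hn
  refine hn _ ?_ ⟨u, hf n u⟩
  rw [LinearMap.mem_ker, hf]
  obtain ⟨k, rfl⟩ := Nat.exists_eq_add_of_le' hn1
  have key : ∀ m : M, z • m = 0 → z ^ (k + 1) • m = 0 := fun m h => by
    rw [pow_succ, mul_smul, h, smul_zero]
  exact key _ hzm

end Central

/-! ### Supports of graded modules -/

section Support

variable {R H M : Type*} [CommRing R] [Ring H] [Algebra R H] {𝒜 : ℕ → AddSubgroup H}
  [GradedRing 𝒜] [AddCommGroup M] [Module R M] [Module H M] [IsScalarTower R H M]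
  {N : ℤ → Submodule R M} [DirectSum.Decomposition N]

/-- A homogeneous element of positive degree acts nilpotently on every `m`, so it lies in each prime
of the support. These primes thus contain `H⁺`, and the class of `1` in `H / H⁺` shows that they
belong to the variety. -/
lemma gradedSupport_subset_of_eventually_eq_bot (hN : ∀ d, ∀ x ∈ 𝒜 d, ShiftsBy N x d)
    (h : ∀ᶠ i in Filter.atTop, N i = ⊥) :
    gradedSupport 𝒜 M ⊆ idealVariety 𝒜 (positiveIdeal 𝒜) := by
  rintro 𝔭 ⟨m, hm⟩
  have h𝔭 := 𝔭.isPrime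
  refine ⟨Submodule.Quotient.mk 1, fun i s hs hs' h0 => hs' ?_⟩
  rw [← Submodule.Quotient.mk_smul, Submodule.Quotient.mk_eq_zero, smul_eq_mul, mul_one] at h0
  refine (Ideal.span_le.2 ?_ : positiveIdeal 𝒜 ≤ 𝔭.toIdeal) h0
  rintro x (⟨-, n, hn⟩ | ⟨i, hi, hx⟩)
  · exact h𝔭.mem_of_pow_mem n (by rw [hn]; exact zero_mem _)
  · by_contra hx'
    have key : ∀ m : M, ∀ᶠ j in Filter.atTop, x ^ j • m = 0 := by
      intro m
      induction m using DirectSum.Decomposition.inductionOn N with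
      | zero => simp
      | @homogeneous k m =>
        obtain ⟨K, hK⟩ := Filter.eventually_atTop.1 h
        filter_upwards [Filter.eventually_ge_atTop (K - k).toNat] with j hj
        have h1 := (hN i x hx).pow j _ _ m.2
        rw [hK] at h1
        · exact (Submodule.mem_bot R).1 h1
        · have : j ≤ j * i := Nat.le_mul_of_pos_right _ hi
          omega
      | add m m' h h' =>
        filter_upwards [h, h'] with j hj hj'
        rw [smul_add, hj, hj', add_zero]
    obtain ⟨j, hj⟩ := (key m).exists
    refine hm (j * i) (x ^ j) ?_ (fun h => hx' (h𝔭.mem_of_pow_mem j h)) hj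
    exact SetLike.pow_mem_graded j hx

/-- If `x` is not nilpotent on `m`, then there is a homogeneous prime in the support which does not
contain `x`. -/
lemma exists_mem_gradedSupport [IsNoetherianRing H] (hcomm : IsGradedCommutative 𝒜)
    (hN : ∀ d, ∀ x ∈ 𝒜 d, ShiftsBy N x d) {x : H} {d : ℕ} (hx : x ∈ 𝒜 d)
    (hxc : x ∈ Subring.center H) {n : ℤ} {m : M} (hm : m ∈ N n) (hm' : ∀ j : ℕ, x ^ j • m ≠ 0) :
    ∃ 𝔭 ∈ gradedSupport 𝒜 M, x ∉ 𝔭.toIdeal := by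
  classical
  have hc : ∀ (j : ℕ) (s : H) (m : M), x ^ j • s • m = s • x ^ j • m := fun j s m => by
    rw [smul_smul, smul_smul, Subring.mem_center_iff.1 (pow_mem hxc j) s]
  -- `P m` is the annihilator of the image of `m` after inverting `x`; a maximal one among
  -- homogeneous `m` is prime, as for associated primes.
  let P : M → Ideal H := fun m =>
    { carrier := {s | ∃ j : ℕ, x ^ j • s • m = 0}
      add_mem' := by
        rintro s t ⟨j, hj⟩ ⟨k, hk⟩
        refine ⟨j + k, ?_⟩
        rw [add_smul, smul_add]
        nth_rewrite 1 [add_comm j k]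
        rw [pow_add, pow_add, mul_smul, mul_smul, hj, hk, smul_zero, smul_zero, add_zero]
      zero_mem' := ⟨0, by simp⟩
      smul_mem' := by
        rintro r s ⟨j, hj⟩
        refine ⟨j, ?_⟩
        rw [smul_assoc, hc, hj, smul_zero] }
  let T : Set (Ideal H) := {I | ∃ n, ∃ m ∈ N n, (∀ j : ℕ, x ^ j • m ≠ 0) ∧ I = P m}
  obtain ⟨_, ⟨n, m, hm, hm', rfl⟩, hmax⟩ :=
    (wellFounded_gt (α := Ideal H)).has_min T ⟨_, n, m, hm, hm', rfl⟩
  have hhom : (P m).IsHomogeneous 𝒜 := by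
    rintro i s ⟨j, hj⟩
    refine ⟨j, ?_⟩
    have h1 := decompose_smul_of_mem_right hN s (((hN d x hx).pow j) _ _ hm) i
    rwa [← hc, hj, DirectSum.decompose_zero, DirectSum.zero_apply, ZeroMemClass.coe_zero, ← hc,
      eq_comm] at h1
  have hcomp : ∀ {I : Ideal H} {s : H},
      (∀ i, (DirectSum.decompose 𝒜 s i : H) ∈ I) → s ∈ I := by
    intro I s h
    rw [← DirectSum.sum_support_decompose 𝒜 s]
    exact sum_mem fun i _ => h i
  have hright : ∀ s ∈ P m, ∀ t, s * t ∈ P m := by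
    intro s hs t
    induction t using DirectSum.Decomposition.inductionOn 𝒜 with
    | zero => simp
    | homogeneous t =>
      rw [← DirectSum.sum_support_decompose 𝒜 s, Finset.sum_mul]
      refine sum_mem fun i _ => ?_
      rcases hcomm.mul_eq_or (SetLike.coe_mem (DirectSum.decompose 𝒜 s i)) t.2 with h | h
      · rw [h]
        exact Ideal.mul_mem_left _ _ (hhom i hs)
      · rw [h]
        exact neg_mem (Ideal.mul_mem_left _ _ (hhom i hs))
    | add t t' h h' =>
      rw [mul_add]
      exact add_mem h h'
  have hprime : (P m).IsPrime := by
    refine hhom.isPrime_of_mul_mem_right ?_ hright ?_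
    · rw [Ideal.ne_top_iff_one]
      rintro ⟨j, hj⟩
      exact hm' j (by simpa using hj)
    · intro i j s hs t ht hst
      by_contra! hcon
      have h1 : ∀ k : ℕ, x ^ k • t • m ≠ 0 := fun k hk => hcon.2 ⟨k, hk⟩
      have h2 : P m ≤ P (t • m) := by
        intro s' hs'
        obtain ⟨k, hk⟩ := hright s' hs' t
        exact ⟨k, by rwa [mul_smul] at hk⟩
      obtain ⟨k, hk⟩ := hst
      have h3 : s ∈ P (t • m) := ⟨k, by rwa [mul_smul] at hk⟩
      exact hmax _ ⟨_, t • m, hN j t ht _ _ hm, h1, rfl⟩ (lt_of_le_of_ne h2 fun h => hcon.1 (h ▸ h3))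
  refine ⟨⟨P m, hhom, hprime⟩, ⟨m, fun i s _ hs' h => hs' ⟨0, by simpa using h⟩⟩, ?_⟩
  rintro ⟨j, hj⟩
  rw [smul_smul, ← pow_succ] at hj
  exact hm' _ hj

lemma eventually_eq_bot_of_gradedSupport_subset [IsNoetherianRing H] [IsNoetherian H M]
    (hcomm : IsGradedCommutative 𝒜) (hN : ∀ d, ∀ x ∈ 𝒜 d, ShiftsBy N x d)
    (h : gradedSupport 𝒜 M ⊆ idealVariety 𝒜 (positiveIdeal 𝒜)) :
    ∀ᶠ i in Filter.atTop, N i = ⊥ := by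
  classical
  obtain ⟨L, hL, hL'⟩ := exists_central_list hcomm hN
  obtain ⟨G, hG, hG'⟩ := exists_homogeneous_generators (H := H) N
  have h1 : ∀ p ∈ L, ∀ q ∈ G, ∃ j : ℕ, p.2 ^ j • q.2 = 0 := by
    intro p hp q hq
    by_contra! hcon
    obtain ⟨hp1, hp2, hp3⟩ := hL p hp
    obtain ⟨𝔭, h𝔭, h𝔭'⟩ := exists_mem_gradedSupport hcomm hN hp2 hp3 (hG q hq) hcon
    obtain ⟨y, hy⟩ := h h𝔭
    obtain ⟨y, rfl⟩ := Submodule.Quotient.mk_surjective _ y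
    refine hy p.1 p.2 hp2 h𝔭' ?_
    rw [← Submodule.Quotient.mk_smul, Submodule.Quotient.mk_eq_zero, smul_eq_mul,
      ← Subring.mem_center_iff.1 hp3]
    exact Ideal.mul_mem_left _ _ (Ideal.subset_span (Or.inr ⟨p.1, hp1, hp2⟩))
  have h2 : ∀ᶠ e in Filter.atTop, ∀ p ∈ L, ∀ q ∈ G, p.2 ^ e • q.2 = 0 := by
    have h3 : ∀ p ∈ L.toFinset, ∀ᶠ e in Filter.atTop, ∀ q ∈ G, p.2 ^ e • q.2 = 0 := by
      intro p hp
      rw [Filter.eventually_all_finset]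
      intro q hq
      obtain ⟨j, hj⟩ := h1 p (List.mem_toFinset.1 hp) q hq
      filter_upwards [Filter.eventually_ge_atTop j] with e he
      obtain ⟨c, rfl⟩ := Nat.exists_eq_add_of_le' he
      rw [pow_add, mul_smul, hj, smul_zero]
    rw [← Filter.eventually_all_finset] at h3
    filter_upwards [h3] with e he p hp
    exact he p (List.mem_toFinset.2 hp)
  obtain ⟨e, he⟩ := h2.exists
  have h3 : ∀ p ∈ L, ∀ m : M, p.2 ^ e • m = 0 := by
    intro p hp m
    have hm : m ∈ Submodule.span H (Prod.snd '' (G : Set (ℤ × M))) := by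
      rw [hG']
      trivial
    induction hm using Submodule.span_induction with
    | zero => simp
    | mem m hm =>
      obtain ⟨q, hq, rfl⟩ := hm
      exact he p hp q hq
    | add m m' _ _ h h' => rw [smul_add, h, h', add_zero]
    | smul r m _ h =>
      rw [smul_smul, ← Subring.mem_center_iff.1 (pow_mem (hL p hp).2.2 e), mul_smul, h, smul_zero]
  have h4 := eventually_le_sumImage_pow e L (fun p hp => hN _ _ (hL p hp).2.1)
    (fun p hp q hq => hcomm.mul_eq_or (hL p hp).2.1 (hL q hq).2.1) (fun _ => ⊥)
    (fun p _ i m hm => by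
      rw [(Submodule.mem_bot R).1 hm, smul_zero]
      exact zero_mem _) (by simpa only [sup_bot_eq] using hL')
  have h5 : ∀ L' : List (ℕ × H), (∀ p ∈ L', p ∈ L) → ∀ i,
      sumImage N (L'.map fun p => (e * p.1, p.2 ^ e)) i = ⊥ := by
    intro L' hL' i
    induction L' with
    | nil => rfl
    | cons p L' ih =>
      change shiftImage N (p.2 ^ e) (e * p.1) i ⊔ sumImage N _ i = ⊥
      rw [ih fun q hq => hL' q (List.mem_cons_of_mem _ hq), sup_bot_eq, eq_bot_iff]
      rintro _ ⟨m, -, rfl⟩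
      exact h3 p (hL' p (by simp)) m
  filter_upwards [h4] with i hi
  rw [h5 L fun _ h => h, sup_bot_eq] at hi
  exact eq_bot_iff.2 hi

end Support

/-! ### Vanishing of the action of a central element -/

section Vanishing

variable {C : Type u₁} [Category.{v₁} C] [Preadditive C] [HasShift C ℤ] [MonoidalCategory C]
  {A : Type u₂} [Category.{v₂} A] [Preadditive A] [HasShift A ℤ]
  [∀ n : ℤ, (shiftFunctor A n).Additive] [MonoidalLeftAction C A] [TriangulatedAction C A]

lemma exists_phiHom_eq (a : A) (p : ℤ) :
    ∃ θ : (𝟙_ C)⟦p⟧ ⊙ₗ a ≅ a⟦p⟧, ∀ h : 𝟙_ C ⟶ (𝟙_ C)⟦p⟧,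
      (phiHom a (p := p) h : a ⟶ a⟦p⟧) =
        (λₗ[C] a).inv ≫ h ⊵ₗ a ≫ θ.hom :=
  ⟨((actFunctor C a).commShiftIso p).app (𝟙_ C) ≪≫ (shiftFunctor A p).mapIso (actUnit C a),
    fun _ => congrArg (fun f => (λₗ[C] a).inv ≫ f) (Category.assoc _ _ _)⟩

lemma phiHom_eq_zero_iff (a : A) {p : ℤ} (h : 𝟙_ C ⟶ (𝟙_ C)⟦p⟧) :
    (phiHom a (p := p) h : a ⟶ a⟦p⟧) = 0 ↔ h ⊵ₗ a = 0 := by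
  obtain ⟨θ, hθ⟩ := exists_phiHom_eq (C := C) a p
  rw [hθ]
  constructor
  · intro h0
    rw [← cancel_epi (λₗ[C] a).inv, ← cancel_mono θ.hom, Category.assoc, h0, comp_zero, zero_comp]
  · intro h0
    rw [h0, zero_comp, comp_zero]

variable {x y : C} (h : x ⟶ y)

lemma actionHomRight_comp_eq_zero {a b : A} (h0 : h ⊵ₗ a = 0) (f : a ⟶ b) :
    (x ⊴ₗ f) ≫ (h ⊵ₗ b) = 0 := by
  rw [MonoidalLeftAction.action_exchange, h0, zero_comp]

lemma actionHomLeft_eq_zero_of_iso {a b : A} (e : a ≅ b) (h0 : h ⊵ₗ a = 0) : h ⊵ₗ b = 0 := by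
  rw [← cancel_epi (x ⊴ₗ e.hom), actionHomRight_comp_eq_zero h h0, comp_zero]

lemma actionHomLeft_shift_one_eq_zero_iff (a : A) :
    h ⊵ₗ (a⟦(1 : ℤ)⟧) = 0 ↔ h ⊵ₗ a = 0 := by
  have key := TriangulatedAction.lam_naturality h (𝟙 a)
  simp only [CategoryTheory.Functor.map_id, MonoidalLeftAction.actionHom_id] at key
  constructor
  · intro h0
    rw [h0, zero_comp] at key
    apply (shiftFunctor A (1 : ℤ)).map_injective
    rw [← cancel_epi (TriangulatedAction.lam x a).hom, ← key, Functor.map_zero, comp_zero]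
  · intro h0
    rw [h0, Functor.map_zero, comp_zero] at key
    rw [← cancel_mono (TriangulatedAction.lam y a).hom, key, zero_comp]

lemma actionHomLeft_shift_eq_zero {a : A} (h0 : h ⊵ₗ a = 0) (n : ℤ) : h ⊵ₗ (a⟦n⟧) = 0 := by
  induction n using Int.induction_on with
  | zero => exact actionHomLeft_eq_zero_of_iso h ((shiftFunctorZero A ℤ).symm.app a) h0
  | succ n ih =>
    exact actionHomLeft_eq_zero_of_iso h ((shiftFunctorAdd' A (n : ℤ) 1 _ rfl).symm.app a)
      ((actionHomLeft_shift_one_eq_zero_iff h _).2 ih)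
  | pred n ih =>
    refine (actionHomLeft_shift_one_eq_zero_iff h _).1 ?_
    exact actionHomLeft_eq_zero_of_iso h
      ((shiftFunctorAdd' A (-(n : ℤ) - 1) 1 (-n) (by ring)).app a) ih

lemma comp_phiHom_eq_zero {a b : A} {p : ℤ} {h : 𝟙_ C ⟶ (𝟙_ C)⟦p⟧} (h0 : h ⊵ₗ a = 0)
    (f : a ⟶ b) :
    f ≫ (phiHom b (p := p) h : b ⟶ b⟦p⟧) = 0 := by
  obtain ⟨θ, hθ⟩ := exists_phiHom_eq (C := C) b p
  rw [hθ, ← Category.assoc, ← MonoidalLeftAction.actionUnitIso_inv_naturality, Category.assoc,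
    ← Category.assoc _ _ θ.hom, actionHomRight_comp_eq_zero h h0, zero_comp, comp_zero]

lemma comp_phiHom_shift_eq_zero {a b : A} {p : ℤ} {h : 𝟙_ C ⟶ (𝟙_ C)⟦p⟧} (h0 : h ⊵ₗ a = 0)
    {n : ℤ} (f : a ⟶ b⟦n⟧) :
    f ≫ (phiHom b (p := p) h : b ⟶ b⟦p⟧)⟦n⟧' = 0 := by
  let e := shiftFunctorCompIsoId A n (-n) (add_neg_cancel n)
  have h2 := comp_phiHom_eq_zero (actionHomLeft_shift_eq_zero h h0 (-n)) (f⟦-n⟧' ≫ e.hom.app b)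
  have h3 := e.hom.naturality (phiHom b (p := p) h : b ⟶ b⟦p⟧)
  apply (shiftFunctor A (-n)).map_injective
  rw [Functor.map_comp, Functor.map_zero, ← cancel_mono (e.hom.app _), zero_comp, Category.assoc]
  refine Eq.trans ?_ h2
  rw [Category.assoc]
  exact congrArg (fun g => f⟦-n⟧' ≫ g) h3

end Vanishing

/-! ### The graded module `Hom^*(a, b)` -/

section HomStar

variable {C : Type u₁} [Category.{v₁} C] [Preadditive C] [HasShift C ℤ]
  [∀ n : ℤ, (shiftFunctor C n).Additive] [MonoidalCategory C]
  {A : Type u₂} [Category.{v₂} A] [Preadditive A] [HasShift A ℤ]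
  [∀ n : ℤ, (shiftFunctor A n).Additive] [MonoidalLeftAction C A] [TriangulatedAction C A]
  {H : Type w} [Ring H] {𝒜 : ℕ → AddSubgroup H} [GradedRing 𝒜] (φ : GradedHomToEnd C 𝒜)

lemma HomStar.of_mem_homDegree (a b : A) {m n : ℤ} (h : m = n) (f : HomFam a b m) :
    HomStar.of φ a b m f ∈ homDegree φ a b n := by
  subst h
  exact ⟨f, rfl⟩

/-- A graded-commutative ring is an algebra over its degree zero part. -/
@[reducible]
def degreeZeroAlgebra (hcomm : IsGradedCommutative 𝒜) :
    letI := degreeZeroCommRing hcomm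
    Algebra (degreeZero 𝒜) H :=
  letI := degreeZeroCommRing hcomm
  { (inferInstance : SMul (degreeZero 𝒜) H) with
    algebraMap := (degreeZero 𝒜).subtype
    commutes' := fun r x => (Subring.mem_center_iff.1
      (hcomm.mem_center_of_even (by simp) r.2 : (r : H) ∈ Subring.center H) x).symm
    smul_def' := fun _ _ => rfl }

lemma shiftsBy_homDegree (hcomm : IsGradedCommutative 𝒜) (a b : A) :
    letI := degreeZeroCommRing hcomm
    ∀ d, ∀ x ∈ 𝒜 d, ShiftsBy (homDegree φ a b) x d := by
  rintro d x hx n _ ⟨f, rfl⟩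
  obtain ⟨g, hg⟩ := φ.map_mem d x hx
  change x • HomStar.of φ a b n f ∈ homDegree φ a b (n + d)
  rw [HomStar.smul_of φ a b hg f]
  exact HomStar.of_mem_homDegree φ a b (add_comm _ _) _

/-- `HomStar.of` with values in `homDegree`. -/
noncomputable def HomStar.toHomDegree (a b : A) (n : ℤ) : HomFam a b n →+ homDegree φ a b n where
  toFun f := ⟨HomStar.of φ a b n f, f, rfl⟩
  map_zero' := Subtype.ext (map_zero _)
  map_add' _ _ := Subtype.ext (map_add _ _ _)

noncomputable instance (a b : A) : DirectSum.Decomposition (homDegree φ a b) :=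
  DirectSum.Decomposition.ofAddHom (homDegree φ a b)
    (DirectSum.map (HomStar.toHomDegree φ a b))
    (DirectSum.addHom_ext fun n f =>
      (congrArg (DirectSum.coeAddMonoidHom (homDegree φ a b)) (DirectSum.map_of _ _ _)).trans
        (DirectSum.coeAddMonoidHom_of _ _ _))
    (DirectSum.addHom_ext (by
      rintro n ⟨_, f, rfl⟩
      exact (congrArg (DirectSum.map (HomStar.toHomDegree φ a b))
        (DirectSum.coeAddMonoidHom_of _ _ _)).trans (DirectSum.map_of _ _ _)))

lemma homDegree_eq_bot_iff {a b : A} {n : ℤ} :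
    homDegree φ a b n = ⊥ ↔ ∀ f : a ⟶ b⟦n⟧, f = 0 := by
  rw [Submodule.eq_bot_iff]
  constructor
  · intro h f
    have h1 := h (HomStar.of φ a b n f) ⟨f, rfl⟩
    exact DirectSum.of_injective (β := HomFam a b) n (h1.trans (map_zero _).symm)
  · rintro h _ ⟨f, rfl⟩
    rw [show f = 0 from h f]
    exact map_zero _

variable [IsNoetherianRing H]

lemma fg_homDegree (hcomm : IsGradedCommutative 𝒜) (a b : A) [Module.Finite H (HomStar φ a b)]
    (n : ℤ) : (homDegree φ a b n).FG := by
  let := degreeZeroCommRing hcomm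
  let := degreeZeroAlgebra hcomm
  have : IsScalarTower (degreeZero 𝒜) H (HomStar φ a b) := ⟨fun r x m => mul_smul (r : H) x m⟩
  exact fg_of_isNoetherian (H := H) (shiftsBy_homDegree φ hcomm a b) (fun x hx => ⟨⟨x, hx⟩, rfl⟩) n

lemma eventually_atBot_hom_eq_zero (hcomm : IsGradedCommutative 𝒜) (a b : A)
    [Module.Finite H (HomStar φ a b)] :
    ∀ᶠ n : ℤ in Filter.atBot, ∀ f : a ⟶ b⟦n⟧, f = 0 := by
  let := degreeZeroCommRing hcomm
  let := degreeZeroAlgebra hcomm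
  have : IsScalarTower (degreeZero 𝒜) H (HomStar φ a b) := ⟨fun r x m => mul_smul (r : H) x m⟩
  filter_upwards [eventually_atBot_eq_bot (H := H) (shiftsBy_homDegree φ hcomm a b)] with n hn
  exact (homDegree_eq_bot_iff φ).1 hn

lemma perfectObjects_iff (hcomm : IsGradedCommutative 𝒜) (a : A)
    [Module.Finite H (HomStar φ a a)] :
    perfectObjects φ a ↔ ∀ᶠ n : ℤ in Filter.atTop, ∀ f : a ⟶ a⟦n⟧, f = 0 := by
  let := degreeZeroCommRing hcomm
  let := degreeZeroAlgebra hcomm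
  have : IsScalarTower (degreeZero 𝒜) H (HomStar φ a a) := ⟨fun r x m => mul_smul (r : H) x m⟩
  simp only [← homDegree_eq_bot_iff φ]
  exact ⟨eventually_eq_bot_of_gradedSupport_subset hcomm (shiftsBy_homDegree φ hcomm a a),
    gradedSupport_subset_of_eventually_eq_bot (shiftsBy_homDegree φ hcomm a a)⟩

/-- If `a` has no self-extensions in high degrees, then `Hom^*(a, b)` vanishes in high degrees for
all `b`. -/
lemma eventually_hom_eq_zero (hcomm : IsGradedCommutative 𝒜) {a : A} (b : A)
    [Module.Finite H (HomStar φ a b)] (h : ∀ᶠ n : ℤ in Filter.atTop, ∀ f : a ⟶ a⟦n⟧, f = 0) :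
    ∀ᶠ n : ℤ in Filter.atTop, ∀ f : a ⟶ b⟦n⟧, f = 0 := by
  let := degreeZeroCommRing hcomm
  let := degreeZeroAlgebra hcomm
  have : IsScalarTower (degreeZero 𝒜) H (HomStar φ a b) := ⟨fun r x m => mul_smul (r : H) x m⟩
  simp only [← homDegree_eq_bot_iff φ]
  refine eventually_eq_bot_of_smul_eq_zero (H := H) (shiftsBy_homDegree φ hcomm a b) ?_
  filter_upwards [tendsto_natCast_atTop_atTop.eventually h] with k hk x hx m
  obtain ⟨g, hg⟩ := φ.map_mem k x hx
  have h1 := (phiHom_eq_zero_iff (C := C) a g).1 (hk _)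
  induction m using DirectSum.Decomposition.inductionOn (homDegree φ a b) with
  | zero => rw [smul_zero]
  | @homogeneous n m =>
    obtain ⟨_, f, rfl⟩ := m
    change x • HomStar.of φ a b n f = 0
    rw [HomStar.smul_of φ a b hg f]
    have h2 : HomFam.mul (phiFam b k g) f = 0 := by
      change (show a ⟶ b⟦n⟧ from f) ≫ (phiHom b (p := (k : ℤ)) g : b ⟶ b⟦(k : ℤ)⟧)⟦n⟧' ≫
        (shiftFunctorAdd' A (k : ℤ) n (k + n) rfl).inv.app b = 0
      rw [← Category.assoc, comp_phiHom_shift_eq_zero h1, zero_comp]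
    rw [h2, map_zero]
  | add m m' h h' => rw [smul_add, h, h', add_zero]

lemma mingen_eq_zero_of_forall {a b : A} {n : ℤ} (h : ∀ f : a ⟶ b⟦n⟧, f = 0) :
    mingen φ a b n = 0 := by
  rw [mingen, (homDegree_eq_bot_iff φ).2 h, Submodule.spanFinrank_bot]

lemma hasGrowth_zero_of_eventually (hcomm : IsGradedCommutative 𝒜)
    (hfin : ∀ a b : A, Module.Finite H (HomStar φ a b)) {a : A}
    (h : ∀ᶠ n : ℤ in Filter.atTop, ∀ f : a ⟶ a⟦n⟧, f = 0) : HasGrowth φ a 0 := by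
  intro b
  obtain ⟨K, hK⟩ := Filter.eventually_atTop.1 (eventually_hom_eq_zero φ hcomm b h)
  obtain ⟨K', hK'⟩ := Filter.eventually_atBot.1 (eventually_atBot_hom_eq_zero φ hcomm a b)
  refine ⟨0, K.natAbs + K'.natAbs, fun n hn => ?_⟩
  rw [zero_mul]
  refine le_of_eq ?_
  rw [Nat.cast_eq_zero]
  apply mingen_eq_zero_of_forall
  rcases abs_cases n with ⟨h1, h2⟩ | ⟨h1, h2⟩
  · exact hK n (by omega)
  · exact hK' n (by omega)

lemma eventually_of_hasGrowth_zero (hcomm : IsGradedCommutative 𝒜)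
    (hfin : ∀ a b : A, Module.Finite H (HomStar φ a b)) {a : A} (h : HasGrowth φ a 0) :
    ∀ᶠ n : ℤ in Filter.atTop, ∀ f : a ⟶ a⟦n⟧, f = 0 := by
  obtain ⟨r, N, hr⟩ := h a
  filter_upwards [Filter.eventually_ge_atTop (N : ℤ), Filter.eventually_gt_atTop (0 : ℤ),
    Filter.eventually_gt_atTop ⌈r⌉] with n hn h0 hnr
  rw [← homDegree_eq_bot_iff φ, ← Submodule.spanFinrank_eq_zero_iff_eq_bot (fg_homDegree φ hcomm a a n)]
  have h1 := hr n (by rwa [abs_of_pos h0])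
  have h2 : (0 : ℝ) < n := by exact_mod_cast h0
  have h3 : r * (|n| : ℝ) ^ (((0 : ℕ) : ℤ) - 1) < 1 := by
    rw [abs_of_pos h2]
    norm_num
    rw [← div_eq_mul_inv, div_lt_one h2]
    exact Int.ceil_le.1 le_rfl |>.trans_lt (by exact_mod_cast hnr)
  have h4 : (mingen φ a a n : ℝ) < 1 := h1.trans_lt h3
  exact Nat.lt_one_iff.1 (by exact_mod_cast h4)

/-- If `a` has complexity at most one over a local ring, then some `g : a ⟶ a⟦D⟧` induces bijections
on `Hom(a, a⟦i⟧)` for all large `i`. -/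
lemma exists_eventually_bijective (hcomm : IsGradedCommutative 𝒜) [IsLocalRing (degreeZero 𝒜)]
    {a : A} [Module.Finite H (HomStar φ a a)] (h : HasGrowth φ a 1) :
    ∃ D : ℕ, 1 ≤ D ∧ ∃ g : a ⟶ a⟦(D : ℤ)⟧, ∀ᶠ i : ℤ in Filter.atTop,
      (∀ f : a ⟶ a⟦(D : ℤ)⟧⟦i⟧, ∃ u : a ⟶ a⟦i⟧, u ≫ g⟦i⟧' = f) ∧
      ∀ u : a ⟶ a⟦i⟧, u ≫ g⟦i⟧' = 0 → u = 0 := by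
  let := degreeZeroCommRing hcomm
  let := degreeZeroAlgebra hcomm
  have : IsScalarTower (degreeZero 𝒜) H (HomStar φ a a) := ⟨fun r x m => mul_smul (r : H) x m⟩
  obtain ⟨r, N, hr⟩ := h a
  obtain ⟨D, hD, z, hz, hzc, hz'⟩ := exists_central_of_bounded (H := H) (N := homDegree φ a a)
    hcomm (fun r => r.2) (fun x hx => ⟨⟨x, hx⟩, rfl⟩) (shiftsBy_homDegree φ hcomm a a)
    (r := ⌈r⌉₊) (by
      filter_upwards [Filter.eventually_ge_atTop (N : ℤ)] with n hn
      have h1 := hr n (hn.trans (le_abs_self n))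
      have h2 : (mingen φ a a n : ℝ) ≤ r := by simpa using h1
      exact_mod_cast h2.trans (Nat.le_ceil r))
  have hinj := eventually_injective_of_le_shiftImage hzc hz'
  obtain ⟨g, hg⟩ := φ.map_mem D z hz
  refine ⟨D, hD, phiHom a (p := (D : ℤ)) g, ?_⟩
  have hsmul : ∀ (i : ℤ) (u : a ⟶ a⟦i⟧), z • HomStar.of φ a a i u =
      HomStar.of φ a a (D + i) (u ≫ (phiHom a (p := (D : ℤ)) g : a ⟶ a⟦(D : ℤ)⟧)⟦i⟧' ≫
        (shiftFunctorAdd' A (D : ℤ) i (D + i) rfl).inv.app a) :=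
    fun i u => HomStar.smul_of φ a a hg u
  filter_upwards [hinj, hz'.int_sub (-D)] with i hi hi'
  constructor
  · intro f
    obtain ⟨_, hu, hu'⟩ := hi' (HomStar.of_mem_homDegree φ a a (by ring)
      (f ≫ (shiftFunctorAdd' A (D : ℤ) i (D + i) rfl).inv.app a : a ⟶ a⟦(D + i : ℤ)⟧))
    rw [show i - -(D : ℤ) - D = i by ring] at hu
    obtain ⟨u, rfl⟩ := hu
    refine ⟨u, ?_⟩
    have h1 := DirectSum.of_injective (β := HomFam a a) _ ((hsmul i u).symm.trans hu')
    rw [← cancel_mono ((shiftFunctorAdd' A (D : ℤ) i (D + i) rfl).inv.app a)]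
    exact (Category.assoc _ _ _).trans h1
  · intro u hu
    have h1 := hsmul i u
    rw [← Category.assoc, hu, zero_comp] at h1
    have h2 := hi _ ⟨u, rfl⟩ (h1.trans (map_zero _))
    exact DirectSum.of_injective (β := HomFam a a) i (h2.trans (map_zero _).symm)

end HomStar

/-! ### Vanishing of morphisms in high degrees and distinguished triangles -/

section Triangles

variable {A : Type u₂} [Category.{v₂} A] [Preadditive A] [HasZeroObject A] [HasShift A ℤ]
  [∀ n : ℤ, (shiftFunctor A n).Additive] [Pretriangulated A]

lemma coyoneda_exact_shift {T : Triangle A} (hT : T ∈ distTriang A) {x : A} {i : ℤ}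
    (f : x ⟶ T.obj₃⟦i⟧) (hf : f ≫ T.mor₃⟦i⟧' = 0) :
    ∃ g : x ⟶ T.obj₂⟦i⟧, f = g ≫ T.mor₂⟦i⟧' := by
  obtain ⟨g, hg⟩ : ∃ g : x ⟶ T.obj₂⟦i⟧, f = g ≫ (i.negOnePow • T.mor₂⟦i⟧') :=
    Triangle.coyoneda_exact₃ _ (Triangle.shift_distinguished T hT i) f (by
      change f ≫ (i.negOnePow • T.mor₃⟦i⟧' ≫ (shiftFunctorComm A 1 i).hom.app T.obj₁) = 0
      rw [Linear.comp_units_smul, ← Category.assoc, hf, zero_comp, smul_zero])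
  refine ⟨i.negOnePow • g, hg.trans ?_⟩
  rw [Linear.comp_units_smul, Linear.units_smul_comp]

lemma eventually_hom_obj₃_eq_zero {T : Triangle A} (hT : T ∈ distTriang A) {x : A}
    (h : ∀ᶠ i : ℤ in Filter.atTop,
      (∀ f : x ⟶ T.obj₂⟦i⟧, ∃ u : x ⟶ T.obj₁⟦i⟧, u ≫ T.mor₁⟦i⟧' = f) ∧
      ∀ u : x ⟶ T.obj₁⟦i⟧, u ≫ T.mor₁⟦i⟧' = 0 → u = 0) :
    ∀ᶠ i : ℤ in Filter.atTop, ∀ f : x ⟶ T.obj₃⟦i⟧, f = 0 := by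
  filter_upwards [h, h.int_sub (-1)] with i hi hi' f
  have h1 : f ≫ T.mor₃⟦i⟧' = 0 := by
    let e := (shiftFunctorAdd' A 1 i (i - -1) (by ring)).symm
    have h2 := e.hom.naturality T.mor₁
    dsimp at h2
    rw [← cancel_mono (e.hom.app T.obj₁), zero_comp]
    apply hi'.2
    rw [Category.assoc, ← h2, Category.assoc, ← Category.assoc (T.mor₃⟦i⟧'), ← Functor.map_comp,
      comp_distTriang_mor_zero₃₁ _ hT, Functor.map_zero, zero_comp, comp_zero]
  obtain ⟨g, rfl⟩ := coyoneda_exact_shift hT f h1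
  obtain ⟨u, rfl⟩ := hi.1 g
  rw [Category.assoc, ← Functor.map_comp, comp_distTriang_mor_zero₁₂ _ hT, Functor.map_zero,
    comp_zero]

lemma eventually_hom_shift_eq_zero {x y : A}
    (h : ∀ᶠ i : ℤ in Filter.atTop, ∀ f : x ⟶ y⟦i⟧, f = 0) (n : ℤ) :
    ∀ᶠ i : ℤ in Filter.atTop, ∀ f : x⟦n⟧ ⟶ y⟦i⟧, f = 0 := by
  filter_upwards [h.int_sub n] with i hi f
  let e := (shiftFunctorAdd' A (i - n) n i (by ring)).app y
  rw [← cancel_mono e.hom, zero_comp]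
  obtain ⟨g, hg⟩ := (shiftFunctor A n).map_surjective (f ≫ e.hom)
  rw [← hg, hi g, Functor.map_zero]

lemma eventually_hom_obj₃_eq_zero' {T : Triangle A} (hT : T ∈ distTriang A) {y : A}
    (h₁ : ∀ᶠ i : ℤ in Filter.atTop, ∀ f : T.obj₁ ⟶ y⟦i⟧, f = 0)
    (h₂ : ∀ᶠ i : ℤ in Filter.atTop, ∀ f : T.obj₂ ⟶ y⟦i⟧, f = 0) :
    ∀ᶠ i : ℤ in Filter.atTop, ∀ f : T.obj₃ ⟶ y⟦i⟧, f = 0 := by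
  filter_upwards [eventually_hom_shift_eq_zero h₁ 1, h₂] with i hi hi' f
  obtain ⟨g, rfl⟩ := Triangle.yoneda_exact₃ T hT f (hi' _)
  rw [hi g, comp_zero]

lemma eventually_bijective_precomp {T : Triangle A} (hT : T ∈ distTriang A) {y : A}
    (h : ∀ᶠ i : ℤ in Filter.atTop, ∀ f : T.obj₃ ⟶ y⟦i⟧, f = 0) :
    ∀ᶠ i : ℤ in Filter.atTop,
      Function.Bijective fun f : T.obj₂ ⟶ y⟦i⟧ => T.mor₁ ≫ f := by
  filter_upwards [h, eventually_hom_shift_eq_zero h (-1)] with i hi hi'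
  constructor
  · intro f f' hff'
    rw [← sub_eq_zero]
    obtain ⟨g, hg⟩ := Triangle.yoneda_exact₂ T hT (f - f')
      (by rw [Preadditive.comp_sub, sub_eq_zero]; exact hff')
    rw [hg, hi g, comp_zero]
  · intro f
    obtain ⟨g, hg⟩ := Triangle.yoneda_exact₂ _ (inv_rot_of_distTriang T hT) f (hi' _)
    exact ⟨g, hg.symm⟩

end Triangles

/-! ### Families of modules up to eventual equality -/

section Germs

variable {R : Type*} [Ring R]

/-- Two morphisms between `ℤ`-indexed families agree in high degrees. -/
def EventuallyEqual : HomRel (ℤ → ModuleCat.{v₂} R) :=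
  fun _ _ f g => ∀ᶠ i in Filter.atTop, f i = g i

instance : Congruence (EventuallyEqual.{v₂} (R := R)) where
  comp_left f _ _ h := h.mono fun i hi => congrArg (f i ≫ ·) hi
  comp_right g h := h.mono fun i hi => congrArg (· ≫ g i) hi
  equivalence :=
    { refl := fun _ => Filter.Eventually.of_forall fun _ => rfl
      symm := fun h => h.mono fun _ hi => hi.symm
      trans := fun h h' => by
        filter_upwards [h, h'] with i hi hi'
        exact hi.trans hi' }

lemma isIso_functor_map {X Y : ℤ → ModuleCat.{v₂} R} (f : X ⟶ Y)
    (hf : ∀ᶠ i in Filter.atTop, IsIso (f i)) :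
    IsIso ((Quotient.functor (EventuallyEqual.{v₂} (R := R))).map f) := by
  classical
  let g : Y ⟶ X := fun i => if h : IsIso (f i) then inv (f i) else 0
  have hg : ∀ i [IsIso (f i)], g i = inv (f i) := fun i h => dif_pos h
  refine ⟨(Quotient.functor EventuallyEqual).map g, ?_, ?_⟩
  · rw [← Functor.map_comp, ← CategoryTheory.Functor.map_id]
    refine CategoryTheory.Quotient.sound _ ?_
    filter_upwards [hf] with i hi
    change f i ≫ g i = 𝟙 _
    rw [@hg i hi]
    exact @IsIso.hom_inv_id _ _ _ _ _ hi
  · rw [← Functor.map_comp, ← CategoryTheory.Functor.map_id]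
    refine CategoryTheory.Quotient.sound _ ?_
    filter_upwards [hf] with i hi
    change g i ≫ f i = 𝟙 _
    rw [@hg i hi]
    exact @IsIso.inv_hom_id _ _ _ _ _ hi

lemma eventually_nonempty_iso {X Y : ℤ → ModuleCat.{v₂} R}
    (e : (Quotient.functor (EventuallyEqual.{v₂} (R := R))).obj X ≅
      (Quotient.functor EventuallyEqual).obj Y) :
    ∀ᶠ i in Filter.atTop, Nonempty (X i ≅ Y i) := by
  obtain ⟨f, hf⟩ := (Quotient.functor (EventuallyEqual.{v₂} (R := R))).map_surjective e.hom
  obtain ⟨g, hg⟩ := (Quotient.functor (EventuallyEqual.{v₂} (R := R))).map_surjective e.inv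
  have h1 := e.hom_inv_id
  have h2 := e.inv_hom_id
  rw [← hf, ← hg, ← Functor.map_comp, ← CategoryTheory.Functor.map_id,
    Quotient.functor_map_eq_iff] at h1 h2
  filter_upwards [h1, h2] with i h1 h2
  exact ⟨⟨f i, g i, h1, h2⟩⟩

end Germs

/-! ### Linear maps between the modules `Hom(a, Σⁿ b)` -/

section HomDegreeMap

variable {C : Type u₁} [Category.{v₁} C] [Preadditive C] [HasShift C ℤ]
  [∀ n : ℤ, (shiftFunctor C n).Additive] [MonoidalCategory C]
  {A : Type u₂} [Category.{v₂} A] [Preadditive A] [HasShift A ℤ]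
  [∀ n : ℤ, (shiftFunctor A n).Additive] [MonoidalLeftAction C A] [TriangulatedAction C A]
  {H : Type w} [Ring H] {𝒜 : ℕ → AddSubgroup H} [GradedRing 𝒜] (φ : GradedHomToEnd C 𝒜)

/-- `Hom(a, Σⁿ b)` as the `H⁰`-module `homDegree φ a b n`. -/
noncomputable def homDegreeEquiv (a b : A) (n : ℤ) : (a ⟶ b⟦n⟧) ≃+ homDegree φ a b n :=
  AddEquiv.ofBijective
    (show (a ⟶ b⟦n⟧) →+ homDegree φ a b n from HomStar.toHomDegree φ a b n)
    ⟨fun f g hfg => DirectSum.of_injective (β := HomFam a b) n (congrArg Subtype.val hfg), by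
      rintro ⟨_, f, rfl⟩
      exact ⟨f, rfl⟩⟩

/-- Elements of `H⁰` act on `Hom(a, Σⁿ b)` through endomorphisms of `b`. -/
lemma exists_smul_homDegreeEquiv (r : degreeZero 𝒜) (b : A) :
    ∃ ε : b ⟶ b, ∀ (a : A) (n : ℤ) (f : a ⟶ b⟦n⟧),
      r • homDegreeEquiv φ a b n f = homDegreeEquiv φ a b n (f ≫ ε⟦n⟧') := by
  obtain ⟨g, hg⟩ := φ.map_mem 0 r r.2
  refine ⟨(phiHom b (p := (0 : ℤ)) g : b ⟶ b⟦(0 : ℤ)⟧) ≫ (shiftFunctorZero A ℤ).hom.app b,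
    fun a n f => Subtype.ext ((HomStar.smul_of φ a b hg f).trans ?_)⟩
  have key : ∀ (m : ℤ) (hm : (0 : ℤ) + n = m),
      HomStar.of φ a b (0 + n) (f ≫ (phiHom b (p := (0 : ℤ)) g : b ⟶ b⟦(0 : ℤ)⟧)⟦n⟧' ≫
        (shiftFunctorAdd' A 0 n (0 + n) rfl).inv.app b) =
      HomStar.of φ a b m (f ≫ (phiHom b (p := (0 : ℤ)) g : b ⟶ b⟦(0 : ℤ)⟧)⟦n⟧' ≫
        (shiftFunctorAdd' A 0 n m hm).inv.app b) := by
    rintro _ rfl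
    rfl
  refine (key n (zero_add n)).trans ?_
  rw [shiftFunctorAdd'_zero_add_inv_app, ← Functor.map_comp]
  rfl

variable {a a' b : A} {k k' : ℤ}

/-- An additive map `Hom(a, Σᵏ b) → Hom(a', Σᵏ' b)` which commutes with the endomorphisms of `b` is
linear over `H⁰`. -/
noncomputable def homDegreeMap (θ : (a ⟶ b⟦k⟧) →+ (a' ⟶ b⟦k'⟧))
    (hθ : ∀ (ε : b ⟶ b) (f : a ⟶ b⟦k⟧), θ (f ≫ ε⟦k⟧') = θ f ≫ ε⟦k'⟧') :
    homDegree φ a b k →ₗ[degreeZero 𝒜] homDegree φ a' b k' where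
  toFun x := homDegreeEquiv φ a' b k' (θ ((homDegreeEquiv φ a b k).symm x))
  map_add' x y := by simp
  map_smul' r x := by
    obtain ⟨f, rfl⟩ := (homDegreeEquiv φ a b k).surjective x
    obtain ⟨ε, hε⟩ := exists_smul_homDegreeEquiv φ r b
    rw [hε, AddEquiv.symm_apply_apply, AddEquiv.symm_apply_apply, hθ, RingHom.id_apply, hε]

lemma homDegreeMap_apply (θ : (a ⟶ b⟦k⟧) →+ (a' ⟶ b⟦k'⟧))
    (hθ : ∀ (ε : b ⟶ b) (f : a ⟶ b⟦k⟧), θ (f ≫ ε⟦k⟧') = θ f ≫ ε⟦k'⟧') (f : a ⟶ b⟦k⟧) :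
    homDegreeMap φ θ hθ (homDegreeEquiv φ a b k f) = homDegreeEquiv φ a' b k' (θ f) :=
  congrArg (fun g => homDegreeEquiv φ a' b k' (θ g)) (AddEquiv.symm_apply_apply _ f)

lemma homDegreeMap_bijective (θ : (a ⟶ b⟦k⟧) →+ (a' ⟶ b⟦k'⟧))
    (hθ : ∀ (ε : b ⟶ b) (f : a ⟶ b⟦k⟧), θ (f ≫ ε⟦k⟧') = θ f ≫ ε⟦k'⟧')
    (h : Function.Bijective θ) : Function.Bijective (homDegreeMap φ θ hθ) :=
  (homDegreeEquiv φ a' b k').bijective.comp (h.comp (homDegreeEquiv φ a b k).symm.bijective)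

lemma mingen_eq_of_bijective (l : homDegree φ a b k →ₗ[degreeZero 𝒜] homDegree φ a' b k')
    (h : Function.Bijective l) : mingen φ a b k = mingen φ a' b k' := by
  rw [mingen, mingen, ← Submodule.spanFinrank_top (homDegree φ a b k),
    ← Submodule.spanFinrank_map_eq_of_injective l h.1, Submodule.map_top,
    LinearMap.range_eq_top.2 h.2, Submodule.spanFinrank_top]

lemma mingen_shift (a b : A) (n m : ℤ) : mingen φ (a⟦n⟧) b m = mingen φ a b (m - n) := by
  let e := (shiftFunctorAdd' A (m - n) n m (by ring)).symm
  let θ : (a ⟶ b⟦m - n⟧) →+ (a⟦n⟧ ⟶ b⟦m⟧) :=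
    AddMonoidHom.mk' (fun u => u⟦n⟧' ≫ e.hom.app b)
      (fun u u' => by rw [Functor.map_add, Preadditive.add_comp])
  refine (mingen_eq_of_bijective φ (homDegreeMap φ θ fun ε f => ?_)
    (homDegreeMap_bijective φ θ _ ⟨fun f f' h => ?_, fun f => ?_⟩)).symm
  · have h1 := e.hom.naturality ε
    dsimp at h1
    change (f ≫ ε⟦m - n⟧')⟦n⟧' ≫ e.hom.app b = (f⟦n⟧' ≫ e.hom.app b) ≫ ε⟦m⟧'
    rw [Functor.map_comp, Category.assoc, h1, Category.assoc]
  · exact (shiftFunctor A n).map_injective ((cancel_mono (e.hom.app b)).1 h)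
  · obtain ⟨g, hg⟩ := (shiftFunctor A n).map_surjective (f ≫ e.inv.app b)
    refine ⟨g, ?_⟩
    change g⟦n⟧' ≫ e.hom.app b = f
    rw [hg, Category.assoc, Iso.inv_hom_id_app]
    exact Category.comp_id f

/-- Composition with `f : a ⟶ a'` as a linear map `Hom(a', Σⁿ b) → Hom(a, Σⁿ b)`. -/
noncomputable def homDegreePrecomp (b : A) (n : ℤ) {a a' : A} (f : a ⟶ a') :
    homDegree φ a' b n →ₗ[degreeZero 𝒜] homDegree φ a b n :=
  homDegreeMap φ (Preadditive.leftComp (b⟦n⟧) f) fun _ _ => (Category.assoc _ _ _).symm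

lemma homDegreePrecomp_apply (b : A) (n : ℤ) {a a' : A} (f : a ⟶ a') (g : a' ⟶ b⟦n⟧) :
    homDegreePrecomp φ b n f (homDegreeEquiv φ a' b n g) = homDegreeEquiv φ a b n (f ≫ g) :=
  homDegreeMap_apply φ _ _ g

lemma homDegreePrecomp_id (a b : A) (n : ℤ) :
    homDegreePrecomp φ b n (𝟙 a) = LinearMap.id := by
  ext x
  obtain ⟨f, rfl⟩ := (homDegreeEquiv φ a b n).surjective x
  rw [homDegreePrecomp_apply, Category.id_comp, LinearMap.id_apply]

lemma homDegreePrecomp_comp (b : A) (n : ℤ) {a a' a'' : A} (f : a ⟶ a') (g : a' ⟶ a'') :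
    homDegreePrecomp φ b n (f ≫ g) =
      (homDegreePrecomp φ b n f).comp (homDegreePrecomp φ b n g) := by
  ext x
  obtain ⟨x, rfl⟩ := (homDegreeEquiv φ _ b n).surjective x
  rw [LinearMap.comp_apply, homDegreePrecomp_apply, homDegreePrecomp_apply,
    homDegreePrecomp_apply, Category.assoc]

lemma homDegreePrecomp_bijective {b : A} {n : ℤ} {a a' : A} {f : a ⟶ a'}
    (h : Function.Bijective fun g : a' ⟶ b⟦n⟧ => f ≫ g) :
    Function.Bijective (homDegreePrecomp φ b n f) :=
  homDegreeMap_bijective φ _ (fun _ _ => (Category.assoc _ _ _).symm) h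

/-- The functor `a ↦ (Hom(a, Σⁿ b))ₙ`. -/
noncomputable def homDegreeFunctor (b : A) : Aᵒᵖ ⥤ (ℤ → ModuleCat (degreeZero 𝒜)) where
  obj a n := ModuleCat.of _ (homDegree φ a.unop b n)
  map f n := ModuleCat.ofHom (homDegreePrecomp φ b n f.unop)
  map_id a := funext fun n => congrArg ModuleCat.ofHom (homDegreePrecomp_id φ a.unop b n)
  map_comp f g := funext fun n =>
    congrArg ModuleCat.ofHom (homDegreePrecomp_comp φ b n g.unop f.unop)

variable [HasZeroObject A] [Pretriangulated A] [IsNoetherianRing H]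

/-- The functor `a ↦ (Hom(a, Σⁿ b))ₙ`, up to equality in high degrees, inverts the morphisms with
perfect cone. -/
lemma isInvertedBy_homDegreeFunctor (hcomm : IsGradedCommutative 𝒜)
    (hfin : ∀ a b : A, Module.Finite H (HomStar φ a b)) (b : A) :
    (perfectObjects (A := A) φ).trW.IsInvertedBy
      (homDegreeFunctor φ b ⋙ Quotient.functor EventuallyEqual).rightOp := by
  rintro a a' f ⟨z, g, h, hT, hz⟩
  have h1 := eventually_hom_eq_zero φ hcomm b ((perfectObjects_iff φ hcomm z).1 hz)
  have h2 := eventually_bijective_precomp hT h1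
  have h3 : IsIso ((Quotient.functor EventuallyEqual).map ((homDegreeFunctor φ b).map f.op)) := by
    refine isIso_functor_map _ ?_
    filter_upwards [h2] with n hn
    rw [ConcreteCategory.isIso_iff_bijective]
    exact homDegreePrecomp_bijective φ hn
  exact (inferInstance : IsIso
    ((Quotient.functor EventuallyEqual).map ((homDegreeFunctor φ b).map f.op)).op)

lemma eventually_mingen_eq (hcomm : IsGradedCommutative 𝒜)
    (hfin : ∀ a b : A, Module.Finite H (HomStar φ a b)) {a a' : A}
    (e : (perfQuotientFunctor φ).obj a ≅ (perfQuotientFunctor φ).obj a') (b : A) :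
    ∀ᶠ n : ℤ in Filter.atTop, mingen φ a b n = mingen φ a' b n := by
  let e' := (Localization.Construction.lift _
    (isInvertedBy_homDegreeFunctor φ hcomm hfin b)).mapIso e
  have h := eventually_nonempty_iso (X := (homDegreeFunctor φ b).obj (Opposite.op a'))
    (Y := (homDegreeFunctor φ b).obj (Opposite.op a)) e'.unop
  filter_upwards [h] with n hn
  obtain ⟨i⟩ := hn
  exact (mingen_eq_of_bijective φ i.toLinearEquiv.toLinearMap i.toLinearEquiv.bijective).symm

end HomDegreeMap

section Growth

variable {C : Type u₁} [Category.{v₁} C] [Preadditive C] [HasShift C ℤ]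
  [∀ n : ℤ, (shiftFunctor C n).Additive] [MonoidalCategory C]
  {A : Type u₂} [Category.{v₂} A] [Preadditive A] [HasShift A ℤ]
  [∀ n : ℤ, (shiftFunctor A n).Additive] [MonoidalLeftAction C A] [TriangulatedAction C A]
  {H : Type w} [Ring H] {𝒜 : ℕ → AddSubgroup H} [GradedRing 𝒜] (φ : GradedHomToEnd C 𝒜)

lemma complexity_eq_one_iff (a : A) :
    complexity φ a = 1 ↔ HasGrowth φ a 1 ∧ ¬ HasGrowth φ a 0 := by
  have hle : ∀ s, HasGrowth φ a s → complexity φ a ≤ s := fun s hs => iInf₂_le s hs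
  have hge : ¬ HasGrowth φ a 0 → 1 ≤ complexity φ a := fun h =>
    le_iInf₂ fun s hs => by
      rcases Nat.eq_zero_or_pos s with rfl | hs'
      · exact absurd hs h
      · exact_mod_cast hs'
  constructor
  · intro h
    have h0 : ¬ HasGrowth φ a 0 := fun h0 => by
      have := hle 0 h0
      rw [h] at this
      simp at this
    refine ⟨by_contra fun h1 => ?_, h0⟩
    have : (2 : ℕ∞) ≤ complexity φ a := le_iInf₂ fun s hs => by
      have hs0 : s ≠ 0 := fun h => h0 (h ▸ hs)
      have hs1 : s ≠ 1 := fun h => h1 (h ▸ hs)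
      have : 2 ≤ s := by omega
      exact_mod_cast this
    rw [h] at this
    exact absurd this (by decide)
  · rintro ⟨h1, h0⟩
    exact le_antisymm (by exact_mod_cast hle 1 h1) (hge h0)

lemma exists_bound_of_eventually_periodic {u : ℤ → ℕ} {n : ℕ} (hn : 0 < n)
    (h : ∀ᶠ m : ℤ in Filter.atTop, u m = u (m - n)) : ∃ r, ∀ᶠ m in Filter.atTop, u m ≤ r := by
  obtain ⟨K, hK⟩ := Filter.eventually_atTop.1 h
  refine ⟨∑ i ∈ Finset.Icc (K - n) K, u i, ?_⟩
  have key : ∀ j : ℕ, ∀ m, K - n ≤ m → m < K + j → u m ≤ ∑ i ∈ Finset.Icc (K - n) K, u i := by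
    intro j
    induction j with
    | zero =>
      intro m hm hm'
      exact Finset.single_le_sum (fun _ _ => Nat.zero_le _)
        (Finset.mem_Icc.2 ⟨hm, by push_cast at hm'; omega⟩)
    | succ j ih =>
      intro m hm hm'
      rcases lt_or_ge m K with h1 | h1
      · exact Finset.single_le_sum (fun _ _ => Nat.zero_le _) (Finset.mem_Icc.2 ⟨hm, h1.le⟩)
      · rw [hK m h1]
        exact ih _ (by omega) (by push_cast at hm'; omega)
  filter_upwards [Filter.eventually_ge_atTop (K - n)] with m hm
  exact key (m - K + 1).toNat m hm (by omega)

variable [HasZeroObject A] [Pretriangulated A] [IsNoetherianRing H]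

lemma hasGrowth_one_of_iso_shift (hcomm : IsGradedCommutative 𝒜)
    (hfin : ∀ a b : A, Module.Finite H (HomStar φ a b)) {a : A} {n : ℕ} (hn : 0 < n)
    (e : (perfQuotientFunctor φ).obj a ≅ (perfQuotientFunctor φ).obj (a⟦(n : ℤ)⟧)) :
    HasGrowth φ a 1 := by
  intro b
  obtain ⟨r, hr⟩ := exists_bound_of_eventually_periodic hn
    ((eventually_mingen_eq φ hcomm hfin e b).mono fun m hm => hm.trans (mingen_shift φ a b n m))
  obtain ⟨K, hK⟩ := Filter.eventually_atTop.1 hr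
  obtain ⟨K', hK'⟩ := Filter.eventually_atBot.1 (eventually_atBot_hom_eq_zero φ hcomm a b)
  refine ⟨r, K.natAbs + K'.natAbs, fun m hm => ?_⟩
  have h1 : mingen φ a b m ≤ r := by
    rcases abs_cases m with ⟨h1, h2⟩ | ⟨h1, h2⟩
    · exact hK m (by omega)
    · rw [mingen_eq_zero_of_forall φ (hK' m (by omega))]
      exact Nat.zero_le r
  simpa using h1

lemma exists_iso_shift_of_hasGrowth_one (hcomm : IsGradedCommutative 𝒜)
    (hfin : ∀ a b : A, Module.Finite H (HomStar φ a b)) [IsLocalRing (degreeZero 𝒜)] {a : A}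
    (h : HasGrowth φ a 1) :
    ∃ n : ℕ, 0 < n ∧
      Nonempty ((perfQuotientFunctor φ).obj a ≅ (perfQuotientFunctor φ).obj (a⟦(n : ℤ)⟧)) := by
  obtain ⟨D, hD, g, hg⟩ := exists_eventually_bijective φ hcomm h
  obtain ⟨z, f, k, hT⟩ := distinguished_cocone_triangle g
  have h1 : ∀ᶠ i : ℤ in Filter.atTop, ∀ f : a ⟶ z⟦i⟧, f = 0 := eventually_hom_obj₃_eq_zero hT hg
  have h2 : ∀ᶠ i : ℤ in Filter.atTop, ∀ f : z ⟶ z⟦i⟧, f = 0 :=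
    eventually_hom_obj₃_eq_zero' hT h1 (eventually_hom_shift_eq_zero h1 _)
  have hW : (perfectObjects (A := A) φ).trW g :=
    ⟨z, f, k, hT, (perfectObjects_iff φ hcomm z).2 h2⟩
  have := MorphismProperty.Q_inverts _ g hW
  exact ⟨D, hD, ⟨asIso ((perfQuotientFunctor φ).map g)⟩⟩

end Growth

theorem mainTheorem6
    {C : Type u₁} [Category.{v₁} C] [Preadditive C] [HasZeroObject C] [HasShift C ℤ]
    [∀ n : ℤ, (shiftFunctor C n).Additive] [Pretriangulated C] [IsTriangulated C]
    [MonoidalCategory C] [MonoidalPreadditive C] [TriangulatedTensorCategory C]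
    {A : Type u₂} [Category.{v₂} A] [Preadditive A] [HasZeroObject A] [HasShift A ℤ]
    [∀ n : ℤ, (shiftFunctor A n).Additive] [Pretriangulated A] [IsTriangulated A]
    [MonoidalLeftAction C A] [TriangulatedAction C A]
    {H : Type w} [Ring H] (𝒜 : ℕ → AddSubgroup H) [GradedRing 𝒜]
    (hcomm : IsGradedCommutative 𝒜) [IsNoetherianRing H]
    (φ : GradedHomToEnd C 𝒜)
    (hfin : ∀ a b : A, Module.Finite H (HomStar φ a b))
    [IsLocalRing (degreeZero 𝒜)]
    (a : A) :
    IsPeriodicObject φ a ↔ complexity φ a = 1 := by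
  rw [complexity_eq_one_iff]
  have hperf : perfectObjects φ a ↔ HasGrowth φ a 0 :=
    (perfectObjects_iff φ hcomm a).trans
      ⟨hasGrowth_zero_of_eventually φ hcomm hfin, eventually_of_hasGrowth_zero φ hcomm hfin⟩
  rw [← hperf]
  constructor
  · rintro ⟨h, n, hn, ⟨e⟩⟩
    exact ⟨hasGrowth_one_of_iso_shift φ hcomm hfin hn e, h⟩
  · rintro ⟨h1, h⟩
    exact ⟨h, exists_iso_shift_of_hasGrowth_one φ hcomm hfin h1⟩
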